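/- Let $N\ge 1$ be an integer, $\lambda>0$, and let $$H=\sum_{j=1}^N\left(-\partial_{x_j}^2+x_j^2\right)+2\lambda(\lambda-1)\sum_{j<k}\frac1{(x_j-x_k)^2},\qquad \psi_0(\mathbf x)=\prod_{j=1}^N e^{-x_j^2/2}\prod_{j<k}(x_k-x_j)^\lambda$$ be the $A_{N-1}$ Calogero Hamiltonian and its groundstate (principal powers) on the set of $\mathbf x\in\mathbb R^N$ with pairwise distinct coordinates. For $\mathbf n\in\mathbb Z^N$, $\epsilon>0$ and $\mathbf x\in\mathbb R^N$ let $$f_{\mathbf n}(\mathbf x)=\prod_{j=1}^N\left(\oint_{\mathcal C_j}\frac{dy_j}{2\pi i\,y_j}\,y_j^{n_j}\right)\frac{\prod_{j<k}(1-y_j/y_k)^\lambda}{\prod_{j,k=1}^N(1-x_j/y_k)^\lambda},$$ where $\mathcal C_j$ is the positively oriented circle $|y_j|=\max_k|x_k|+\epsilon j$. Put $\tilde m_j=m_j+\lambda(N+1-j)$, $$g_{jk}(\nu;\mathbf m)=2\lambda(\lambda-1)\nu(1-\delta_{jk})-\tilde m_j(\tilde m_j+1)\delta_{\nu0}\delta_{jk},\qquad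 \mathbf E^\nu_{jk}=(1-\nu)\mathbf e_j+(1+\nu)\mathbf e_k,$$ and, for $\mathbf n,\mathbf m\in\mathbb Z^N$, $$\alpha_{\mathbf n}(\mathbf m)=\delta_{\mathbf n,\mathbf m}+\sum_{s=1}^\infty\frac1{4^s s!}\sum_{j_1\le k_1}\cdots\sum_{j_s\le k_s}\ \sum_{\nu_1,\dots,\nu_s=0}^\infty\delta_{\mathbf n,\ \mathbf m+\sum_{r=1}^s\mathbf E^{\nu_r}_{j_rk_r}}\ \prod_{r=1}^s g_{j_rk_r}\Bigl(\nu_r;\ \mathbf n-\sum_{\ell=1}^r\mathbf E^{\nu_\ell}_{j_\ell k_\ell}\Bigr).$$ Then, for every $\mathbf n\in\mathbb Z^N$: 1. All functions $f_{\mathbf m}$, $\mathbf m\in\mathbb Z^N$, are symmetric polynomials and do not depend on $\epsilon>0$. 2. For every $\mathbf m$ the sums defining $\alpha_{\mathbf n}(\mathbf m)$ have only finitely many non-zero terms, and only finitely many $\mathbf m$ satisfy $\alpha_{\mathbf n}(\mathbf m)\neq0$ and $f_{\mathbf m}\neq0$. 3. The function $P_{\mathbf n}=\sum_{\mathbf m}\alpha_{\mathbf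 n}(\mathbf m)f_{\mathbf m}$ is a reduced polynomial eigenfunction of the Calogero model with eigenvalue $E_{\mathbf n}=2(n_1+\dots+n_N)+N(1+\lambda(N-1))$; that is, $P_{\mathbf n}$ is a symmetric polynomial and $H(\psi_0P_{\mathbf n})=E_{\mathbf n}\,\psi_0P_{\mathbf n}$ at all points with pairwise distinct coordinates. (It is not claimed that $P_{\mathbf n}\ne0$; for instance $P_{\mathbf n}=0$ when $n_1+\dots+n_N<0$.) -/

import Mathlib

open scoped Nat

namespace Calogero

noncomputable section

/-! ### The Calogero Hamiltonian and its reduced polynomial eigenfunctions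

Coordinates are indexed by `Fin N`, so that the index `j : Fin N` stands for the particle number
`j + 1` in the usual numbering `1, …, N`. The coupling parameter is `lam`. -/

/-- The second partial derivative of `ψ` with respect to the coordinate `x j`. -/
def secondPartial {N : ℕ} (ψ : (Fin N → ℝ) → ℂ) (j : Fin N) (x : Fin N → ℝ) : ℂ :=
  iteratedDeriv 2 (fun t : ℝ => ψ (Function.update x j t)) (x j)

/-- `H = ∑ j, (-∂_j² + x_j²) + 2 λ (λ - 1) ∑_{j < k} 1 / (x_j - x_k)²`. -/
def hamiltonian {N : ℕ} (lam : ℝ) (ψ : (Fin N → ℝ) → ℂ) (x : Fin N → ℝ) : ℂ :=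
  ∑ j, (-secondPartial ψ j x + (x j : ℂ) ^ 2 * ψ x) +
    2 * (lam : ℂ) * ((lam : ℂ) - 1) *
      (∑ j, ∑ k ∈ Finset.Ioi j, 1 / ((x j : ℂ) - (x k : ℂ)) ^ 2) * ψ x

/-- The groundstate `∏ j, exp (-x_j² / 2) * ∏_{j < k} (x_k - x_j) ^ λ`; the powers are principal
ones, so each factor `(x_k - x_j) ^ λ` is `|x_k - x_j| ^ λ` times a constant phase on each of the
two half-spaces `x_j < x_k` and `x_k < x_j`. -/
def groundState {N : ℕ} (lam : ℝ) (x : Fin N → ℝ) : ℂ :=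
  (∏ j, Complex.exp (-(1 / 2) * (x j : ℂ) ^ 2)) *
    ∏ j, ∏ k ∈ Finset.Ioi j, ((x k : ℂ) - (x j : ℂ)) ^ (lam : ℂ)

/-- `ψ` is a (classical) solution of `H ψ = E ψ` off the coincidence hyperplanes `x_j = x_k`,
where `H` is singular. -/
def SolvesSchrodinger {N : ℕ} (lam : ℝ) (ψ : (Fin N → ℝ) → ℂ) (E : ℝ) : Prop :=
  ∀ x : Fin N → ℝ, Function.Injective x →
    ContDiffAt ℝ 2 ψ x ∧ hamiltonian lam ψ x = (E : ℂ) * ψ x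

/-- The function `f` on `ℝ^N` is given by a symmetric polynomial (with real coefficients). -/
def IsSymmPolynomial {N : ℕ} (f : (Fin N → ℝ) → ℂ) : Prop :=
  ∃ p : MvPolynomial (Fin N) ℝ, p.IsSymmetric ∧
    ∀ x : Fin N → ℝ, f x = ((MvPolynomial.eval x p : ℝ) : ℂ)

/-- `P` is a symmetric polynomial such that `ψ₀ P` satisfies `H (ψ₀ P) = E ψ₀ P`. -/
def IsReducedPolynomialEigenfunction {N : ℕ} (lam : ℝ) (P : (Fin N → ℝ) → ℂ) (E : ℝ) : Prop :=
  IsSymmPolynomial P ∧ SolvesSchrodinger lam (fun x => groundState lam x * P x) E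

/-- `E_n = 2 (n_1 + ⋯ + n_N) + N (1 + λ (N - 1))`. -/
def energy {N : ℕ} (lam : ℝ) (n : Fin N → ℤ) : ℝ :=
  2 * (∑ j, (n j : ℝ)) + (N : ℝ) * (1 + lam * ((N : ℝ) - 1))

/-! ### The functions `f_n` -/

/-- The radius of the `j`-th circle of integration, `max_k |x_k| + ε j` with `j` counted from `1`
(the norm on `Fin N → ℝ` is the maximum norm). -/
def radius {N : ℕ} (ε : ℝ) (x : Fin N → ℝ) (j : Fin N) : ℝ :=
  ‖x‖ + ε * ((j : ℝ) + 1)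

/-- The integrand of `f_n`: `∏_j y_j ^ n_j / (2 π i y_j)` times
`∏_{j < k} (1 - y_j / y_k) ^ λ / ∏_{j, k} (1 - x_j / y_k) ^ λ`, with principal powers. -/
def fIntegrand {N : ℕ} (lam : ℝ) (n : Fin N → ℤ) (x : Fin N → ℝ) (y : Fin N → ℂ) : ℂ :=
  (∏ j, y j ^ n j / (2 * (Real.pi : ℂ) * Complex.I * y j)) *
    ((∏ j, ∏ k ∈ Finset.Ioi j, (1 - y j / y k) ^ (lam : ℂ)) /
      ∏ j, ∏ k, (1 - (x j : ℂ) / y k) ^ (lam : ℂ))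

/-- The contour integral `f_n(x)` over the nested circles `|y_j| = max_k |x_k| + ε j`. -/
def f {N : ℕ} (lam ε : ℝ) (n : Fin N → ℤ) (x : Fin N → ℝ) : ℂ :=
  torusIntegral (fIntegrand lam n x) 0 (radius ε x)

/-! ### The coefficients -/

/-- `m̃_j = m_j + λ (N + 1 - j)` with `j` counted from `1`. -/
def shifted {N : ℕ} (lam : ℝ) (m : Fin N → ℤ) (j : Fin N) : ℝ :=
  (m j : ℝ) + lam * ((N : ℝ) + 1 - ((j : ℝ) + 1))

/-- `g_{jk}(ν; m) = 2 λ (λ - 1) ν (1 - δ_{jk}) - m̃_j (m̃_j + 1) δ_{ν0} δ_{jk}`. -/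
def g {N : ℕ} (lam : ℝ) (j k : Fin N) (ν : ℕ) (m : Fin N → ℤ) : ℝ :=
  2 * lam * (lam - 1) * (ν : ℝ) * (1 - (if j = k then 1 else 0)) -
    shifted lam m j * (shifted lam m j + 1) * (if ν = 0 then 1 else 0) * (if j = k then 1 else 0)

/-- `E_{jk}^ν = (1 - ν) e_j + (1 + ν) e_k`. -/
def shift {N : ℕ} (j k : Fin N) (ν : ℕ) : Fin N → ℤ :=
  (1 - (ν : ℤ)) • Pi.single j 1 + (1 + (ν : ℤ)) • Pi.single k 1

/-- A summation index `(j, k, ν)` with `j ≤ k` and `ν ≥ 0`. -/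
structure Step (N : ℕ) where
  j : Fin N
  k : Fin N
  le : j ≤ k
  ν : ℕ

/-- The vector `E_{jk}^ν` of a step. -/
def Step.vec {N : ℕ} (c : Step N) : Fin N → ℤ := shift c.j c.k c.ν

/-- The summand belonging to a chain of `s` steps:
`δ_n(m + ∑_r E_{j_r k_r}^{ν_r}) ∏_r g_{j_r k_r}(ν_r; n - ∑_{ℓ ≤ r} E_{j_ℓ k_ℓ}^{ν_ℓ})`. -/
def chainTerm {N : ℕ} (lam : ℝ) (n m : Fin N → ℤ) {s : ℕ} (c : Fin s → Step N) : ℝ :=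
  (if m + ∑ r, (c r).vec = n then 1 else 0) *
    ∏ r, g lam (c r).j (c r).k (c r).ν (n - ∑ l ∈ Finset.Iic r, (c l).vec)

/-- `α_n(m) = δ_n(m) + ∑_{s ≥ 1} 1 / (4^s s!) ∑_{chains of s steps} chainTerm`. -/
def alpha {N : ℕ} (lam : ℝ) (n m : Fin N → ℤ) : ℝ :=
  (if m = n then 1 else 0) +
    ∑ᶠ (s : ℕ) (_ : 1 ≤ s), 1 / ((4 : ℝ) ^ s * (s ! : ℝ)) *
      ∑ᶠ c : Fin s → Step N, chainTerm lam n m c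

/-- `P_n = ∑_m α_n(m) f_m`. -/
def P {N : ℕ} (lam ε : ℝ) (n : Fin N → ℤ) (x : Fin N → ℝ) : ℂ :=
  ∑ᶠ m : Fin N → ℤ, (alpha lam n m : ℂ) * f lam ε m x

end

end Calogero

/-! With `t_k = 1 / y_k`, the integrals `f_m` are the coefficients of `∏ t_k ^ m_k` in the
generating function `F = ∏_{j<k} (1 - t_k/t_j)^λ ∏_{j,k} (1 - x_j t_k)^(-λ)`, expanded where `t_1 ≫
t_2 ≫ ⋯`. Conjugating `H` by the groundstate and subtracting its energy leaves `-∑ ∂_i² + 2 ∑ x_i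
∂_i - 2λ ∑_{i<j} (∂_i - ∂_j)/(x_i - x_j)`. On `F` this operator in `x` can be traded for one in `t`:
homogeneity turns `∑ x_i ∂_i` into `∑ t_k ∂/∂t_k` (`euler_genSeries`), and `genSeries_pde` turns the
remaining part into multiplication by `t_k²`, with shifted Euler operators, and by `t_i t_j
r/(1-r)²` with `r = t_j/t_i`. Since `r/(1-r)² = ∑ ν r^ν`, reading off coefficients gives a
triangular action (`fPoly_reduced`): `f_m` goes to `2|m| f_m` plus the terms `g_{jk}(ν; m - E)
f_{m-E}` with `E = E_{jk}^ν`, where `|m| = ∑ m_i`.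

Hence `∑ α(m) f_m` has eigenvalue `2|n|` as soon as `2(|n| - |m|) α(m) = ∑ g(m) α(m + E)`. Every
step changes `|m|` by 2, so a chain of `s` steps meets the energy gaps `4, 8, …, 4s`, whose product
`4^s s!` is the denominator in `α` (`alpha_recurrence`). All sums are finite because steps have
nonnegative tail sums `m_k + ⋯ + m_N`: `α_n(m) ≠ 0` bounds the tails of `m` from above by those of
`n`, and `f_m ≠ 0` bounds them from below by 0.

The differential equation is proved by pure algebra in a domain of formal power series, where it
reduces to the partial fraction identities `expFrac_mul_pole` and `expFrac_cyclic`. Analysis enters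
twice: the contour integrals are matched with formal coefficients by termwise integration
(`f_eq_fPoly`), and the groundstate is differentiated off the hyperplanes
(`secondPartial_groundState_mul`). Symmetry of `f_m` is visible from the integral. -/

namespace Calogero
noncomputable section

/-! ### Formal binomial series and coefficientwise derivations -/

/-- The coefficients of `(1 - w) ^ μ`. -/
def binCoeff (μ : ℝ) (n : ℕ) : ℝ := (-1) ^ n * Ring.choose μ n

lemma binCoeff_zero (μ : ℝ) : binCoeff μ 0 = 1 := by simp [binCoeff]

lemma binCoeff_succ (μ : ℝ) (n : ℕ) :
    ((n : ℝ) + 1) * binCoeff μ (n + 1) = ((n : ℝ) - μ) * binCoeff μ n := by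
  have h1 := Ring.descPochhammer_eq_factorial_smul_choose μ n
  have h2 := Ring.descPochhammer_eq_factorial_smul_choose μ (n + 1)
  rw [descPochhammer_succ_right, Polynomial.smeval_mul, h1] at h2
  have h3 : (Polynomial.X - (n : Polynomial ℤ)).smeval μ = μ - n := by
    rw [Polynomial.smeval_sub]; simp [Polynomial.smeval_X, Polynomial.smeval_natCast]
  rw [h3] at h2
  have h4 : (n ! : ℝ) ≠ 0 := by positivity
  simp only [nsmul_eq_mul, Nat.factorial_succ, Nat.cast_mul] at h2
  have h5 : ((n : ℝ) + 1) * Ring.choose μ (n + 1) = (μ - n) * Ring.choose μ n := by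
    apply mul_left_cancel₀ h4
    push_cast at h2
    linear_combination -h2
  unfold binCoeff
  rw [pow_succ]
  linear_combination (-(-1) ^ n) * h5

section BinomialSeries

set_option linter.unusedSectionVars false

variable {σ R : Type*} [CommRing R] [Algebra ℝ R]

/-- The formal binomial series `(1 - w) ^ μ` for `w` without constant term. -/
def binSeries (μ : ℝ) (w : MvPowerSeries σ R) : MvPowerSeries σ R := fun b =>
  MvPowerSeries.coeff b (∑ n ∈ Finset.range (b.degree + 1), binCoeff μ n • w ^ n)

lemma coeff_mul_eq_zero_of_degree_lt {b : σ →₀ ℕ} {M : ℕ} (hM : b.degree < M)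
    {w : MvPowerSeries σ R} (hw : MvPowerSeries.constantCoeff w = 0) (G : MvPowerSeries σ R) :
    MvPowerSeries.coeff b (G * w ^ M) = 0 := by
  classical
  rw [MvPowerSeries.coeff_mul]
  refine Finset.sum_eq_zero fun p hp => ?_
  rw [MvPowerSeries.coeff_eq_zero_of_constantCoeff_nilpotent (m := 1) (by simp [hw]), mul_zero]
  have := congrArg Finsupp.degree (Finset.HasAntidiagonal.mem_antidiagonal.mp hp)
  rw [map_add] at this
  omega

/-- Powers of `w` beyond the degree of `b` do not reach the coefficient at `b`, so the truncation
may be taken longer than the definition does. This allows one common truncation for all coefficients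
of bounded degree. -/
lemma coeff_binSeries (μ : ℝ) {w : MvPowerSeries σ R} (hw : MvPowerSeries.constantCoeff w = 0)
    {b : σ →₀ ℕ} {M : ℕ} (hM : b.degree < M) :
    MvPowerSeries.coeff b (binSeries μ w) =
      MvPowerSeries.coeff b (∑ n ∈ Finset.range M, binCoeff μ n • w ^ n) := by
  change MvPowerSeries.coeff b (∑ n ∈ Finset.range (b.degree + 1), binCoeff μ n • w ^ n) = _
  rw [map_sum, map_sum]
  refine Finset.sum_subset (by simpa using hM) fun n _ hn => ?_
  have hn : b.degree < n := by simpa using hn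
  have := coeff_mul_eq_zero_of_degree_lt hn hw (binCoeff μ n • 1)
  simpa using this

lemma coeff_mul_congr {b : σ →₀ ℕ} (G : MvPowerSeries σ R) {S T : MvPowerSeries σ R}
    (h : ∀ c : σ →₀ ℕ, c.degree ≤ b.degree → MvPowerSeries.coeff c S = MvPowerSeries.coeff c T) :
    MvPowerSeries.coeff b (G * S) = MvPowerSeries.coeff b (G * T) := by
  classical
  rw [MvPowerSeries.coeff_mul, MvPowerSeries.coeff_mul]
  refine Finset.sum_congr rfl fun p hp => ?_
  rw [h]
  have := congrArg Finsupp.degree (Finset.HasAntidiagonal.mem_antidiagonal.mp hp)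
  rw [map_add] at this
  omega

/-- A derivation of power series that acts on each coefficient separately. -/
def coeffDerivation (d : (σ →₀ ℕ) → R →ₗ[ℝ] R)
    (hd : ∀ a b u v, d (a + b) (u * v) = u * d b v + v * d a u) :
    Derivation ℝ (MvPowerSeries σ R) (MvPowerSeries σ R) :=
  Derivation.mk'
    { toFun := fun p b => d b (MvPowerSeries.coeff b p)
      map_add' := fun p q => by
        funext b
        exact (congrArg (d b) (map_add (MvPowerSeries.coeff b) p q)).trans (map_add (d b) _ _)
      map_smul' := fun r p => by
        funext b
        exact map_smul (d b) r (MvPowerSeries.coeff b p) }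
    (fun p q => by
      classical
      ext b
      change d b (MvPowerSeries.coeff b (p * q)) = _
      rw [smul_eq_mul, smul_eq_mul, map_add, mul_comm q, MvPowerSeries.coeff_mul,
        MvPowerSeries.coeff_mul, MvPowerSeries.coeff_mul, map_sum, ← Finset.sum_add_distrib]
      refine Finset.sum_congr rfl fun c hc => ?_
      conv_lhs => rw [← Finset.HasAntidiagonal.mem_antidiagonal.mp hc]
      rw [hd, mul_comm (MvPowerSeries.coeff c.2 q)]
      rfl)

lemma coeff_coeffDerivation (d : (σ →₀ ℕ) → R →ₗ[ℝ] R) (hd) (p : MvPowerSeries σ R)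
    (b : σ →₀ ℕ) :
    MvPowerSeries.coeff b (coeffDerivation d hd p) = d b (MvPowerSeries.coeff b p) := rfl

/-- The differential equation `(1 - w) S' + μ S = 0` of `(1 - w)^μ`, for a partial sum: the
recursion of the coefficients cancels everything except the top power. -/
lemma sum_binCoeff_telescope (μ : ℝ) (w : MvPowerSeries σ R) (K : ℕ) :
    (1 - w) * ∑ n ∈ Finset.range (K + 1), binCoeff μ n • ((n : MvPowerSeries σ R) * w ^ (n - 1)) +
      μ • ∑ n ∈ Finset.range (K + 1), binCoeff μ n • w ^ n =
      ((μ - K) * binCoeff μ K) • w ^ K := by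
  induction K with
  | zero => simp [binCoeff_zero]
  | succ K ih =>
    rw [Finset.sum_range_succ _ (K + 1), Finset.sum_range_succ _ (K + 1), mul_add, smul_add]
    have h := binCoeff_succ μ K
    have e : ((μ - K) * binCoeff μ K) • w ^ K = (-(((K : ℝ) + 1) * binCoeff μ (K + 1))) • w ^ K := by
      rw [h]; congr 1; ring
    rw [e] at ih
    simp only [Algebra.smul_def, Nat.add_sub_cancel] at ih ⊢
    push_cast [map_sub, map_mul, map_neg, map_add, map_natCast, map_one] at ih ⊢
    linear_combination ih

lemma coeffDerivation_binSeries (d : (σ →₀ ℕ) → R →ₗ[ℝ] R) (hd) (μ : ℝ)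
    {w : MvPowerSeries σ R} (hw : MvPowerSeries.constantCoeff w = 0) :
    (1 - w) * coeffDerivation d hd (binSeries μ w) =
      -(μ • (coeffDerivation d hd w * binSeries μ w)) := by
  ext b
  -- The sum ends at the power `b.degree + 1`, so that the telescoping error is a multiple of `w ^
  -- (b.degree + 1)`, invisible at `b`.
  set S : MvPowerSeries σ R := ∑ n ∈ Finset.range (b.degree + 2), binCoeff μ n • w ^ n with hS
  have h1 : MvPowerSeries.coeff b ((1 - w) * coeffDerivation d hd (binSeries μ w)) =
      MvPowerSeries.coeff b ((1 - w) * coeffDerivation d hd S) :=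
    coeff_mul_congr _ fun c hc => by
      rw [coeff_coeffDerivation, coeff_coeffDerivation, coeff_binSeries μ hw (show c.degree < b.degree + 2 by omega)]
  have h2 : MvPowerSeries.coeff b (coeffDerivation d hd w * binSeries μ w) =
      MvPowerSeries.coeff b (coeffDerivation d hd w * S) :=
    coeff_mul_congr _ fun c hc => coeff_binSeries μ hw (by omega)
  have h3 : coeffDerivation d hd S = coeffDerivation d hd w *
      ∑ n ∈ Finset.range (b.degree + 2), binCoeff μ n • ((n : MvPowerSeries σ R) * w ^ (n - 1)) := by
    rw [hS, map_sum, Finset.mul_sum]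
    refine Finset.sum_congr rfl fun n _ => ?_
    rw [Derivation.map_smul, Derivation.leibniz_pow, mul_smul_comm]
    congr 1
    simp only [smul_eq_mul, nsmul_eq_mul]
    ring
  have h4 := sum_binCoeff_telescope μ w (b.degree + 1)
  have h5 : (1 - w) * coeffDerivation d hd S = -(μ • (coeffDerivation d hd w * S)) +
      ((μ - (b.degree + 1 : ℕ)) * binCoeff μ (b.degree + 1)) •
        (coeffDerivation d hd w * w ^ (b.degree + 1)) := by
    rw [h3]
    change _ * ∑ n ∈ Finset.range (b.degree + 2), _ + μ • S = _ at h4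
    generalize ∑ n ∈ Finset.range (b.degree + 2),
      binCoeff μ n • ((n : MvPowerSeries σ R) * w ^ (n - 1)) = T at h4 ⊢
    simp only [Algebra.smul_def] at h4 ⊢
    linear_combination coeffDerivation d hd w * h4
  rw [h1, h5, map_add, map_neg, map_neg]
  have h6 : ∀ (r : ℝ) (p : MvPowerSeries σ R), MvPowerSeries.coeff b (r • p) =
    r • MvPowerSeries.coeff b p := fun _ _ => rfl
  rw [h6, h6, h6, h2, coeff_mul_eq_zero_of_degree_lt (Nat.lt_succ_self _) hw, smul_zero, add_zero]

/-- The formal inverse of `1 - w` for `w` without constant term. -/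
def geomInv (w : MvPowerSeries σ R) : MvPowerSeries σ R := MvPowerSeries.invOfUnit (1 - w) 1

lemma one_sub_mul_geomInv {w : MvPowerSeries σ R} (hw : MvPowerSeries.constantCoeff w = 0) :
    (1 - w) * geomInv w = 1 :=
  MvPowerSeries.mul_invOfUnit _ _ (by simp [hw])

lemma derivation_geomInv (δ : Derivation ℝ (MvPowerSeries σ R) (MvPowerSeries σ R))
    {w : MvPowerSeries σ R} (hw : MvPowerSeries.constantCoeff w = 0) :
    δ (geomInv w) = geomInv w ^ 2 * δ w := by
  have h := one_sub_mul_geomInv hw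
  have h2 := congrArg δ h
  rw [Derivation.leibniz, map_sub, Derivation.map_one_eq_zero, smul_eq_mul, smul_eq_mul] at h2
  linear_combination geomInv w * h2 - δ (geomInv w) * h

lemma coeffDerivation_binSeries_eq (d : (σ →₀ ℕ) → R →ₗ[ℝ] R) (hd) (μ : ℝ)
    {w : MvPowerSeries σ R} (hw : MvPowerSeries.constantCoeff w = 0) :
    coeffDerivation d hd (binSeries μ w) =
      (-(μ • (geomInv w * coeffDerivation d hd w))) * binSeries μ w := by
  have h := one_sub_mul_geomInv hw
  have h2 := coeffDerivation_binSeries d hd μ hw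
  simp only [Algebra.smul_def] at h2 ⊢
  linear_combination geomInv w * h2 - coeffDerivation d hd (binSeries μ w) * h

end BinomialSeries

lemma derivation_prod {ι A : Type*} [CommRing A] [Algebra ℝ A] (δ : Derivation ℝ A A)
    (s : Finset ι) (S a : ι → A) (h : ∀ i ∈ s, δ (S i) = a i * S i) :
    δ (∏ i ∈ s, S i) = (∑ i ∈ s, a i) * ∏ i ∈ s, S i := by
  classical
  induction s using Finset.induction_on with
  | empty => simp
  | insert i s hi ih =>
    rw [Finset.prod_insert hi, Finset.sum_insert hi, Derivation.leibniz,
      ih fun j hj => h j (Finset.mem_insert_of_mem hj), h i (Finset.mem_insert_self _ _)]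
    simp only [smul_eq_mul]
    ring

/-- If `c_k Y_kl Y_km` sums cyclically to zero, then the mixed terms of `∑ c_k (∑ Y_kl)²` cancel. -/
lemma sum_mul_sq_sum_of_cyclic {ι A : Type*} [Fintype ι] [CommRing A] [NoZeroDivisors A]
    [CharZero A] (c : ι → A) (Y : ι → ι → A) (h0 : ∀ k, Y k k = 0)
    (h : ∀ k l m, k ≠ l → k ≠ m → l ≠ m →
      c k * Y k l * Y k m + c l * Y l k * Y l m + c m * Y m k * Y m l = 0) :
    ∑ k, c k * (∑ l, Y k l) ^ 2 = ∑ k, ∑ l, c k * Y k l ^ 2 := by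
  classical
  -- The product with its diagonal `l = m` removed. Its sum over the three choices of the
  -- distinguished index vanishes for every triple, also with coincidences, so three times its total
  -- is zero.
  let T : ι → ι → ι → A := fun k l m => c k * Y k l * Y k m - if l = m then c k * Y k l ^ 2 else 0
  have hT : ∀ k l m, T k l m + T l k m + T m k l = 0 := by
    intro k l m
    simp only [T]
    by_cases h1 : k = l
    · subst h1
      by_cases h2 : k = m
      · subst h2; simp [h0]
      · have h3 : m ≠ k := fun e => h2 e.symm
        simp [h0, h2]; ring
    · have h1' : l ≠ k := fun e => h1 e.symm
      by_cases h2 : k = m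
      · subst h2; simp [h0, h1, h1']; ring
      · by_cases h3 : l = m
        · subst h3; simp [h0, h2]; ring
        · simp [h1, h2, h3]
          linear_combination h k l m h1 h2 h3
  have hS : ∑ k, ∑ l, ∑ m, T k l m = 0 := by
    have e1 : ∑ k, ∑ l, ∑ m, T l k m = ∑ k, ∑ l, ∑ m, T k l m := Finset.sum_comm
    have e2 : ∑ k, ∑ l, ∑ m, T m k l = ∑ k, ∑ l, ∑ m, T k l m := by
      calc ∑ k, ∑ l, ∑ m, T m k l = ∑ k, ∑ m, ∑ l, T m k l :=
            Finset.sum_congr rfl fun k _ => Finset.sum_comm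
        _ = _ := Finset.sum_comm
    have e3 : ∑ k, ∑ l, ∑ m, (T k l m + T l k m + T m k l) = 0 := by simp [hT]
    simp only [Finset.sum_add_distrib] at e3
    rw [e1, e2] at e3
    have : (3 : A) * ∑ k, ∑ l, ∑ m, T k l m = 0 := by linear_combination e3
    exact (mul_eq_zero.mp this).resolve_left (by norm_num)
  rw [← sub_eq_zero, ← hS, ← Finset.sum_sub_distrib]
  refine Finset.sum_congr rfl fun k _ => ?_
  simp only [T, Finset.sum_sub_distrib, Finset.sum_ite_eq, Finset.mem_univ, if_true]
  congr 1
  rw [sq, Finset.sum_mul_sum, Finset.mul_sum]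
  refine Finset.sum_congr rfl fun l _ => ?_
  rw [Finset.mul_sum]
  exact Finset.sum_congr rfl fun m _ => by ring

end

noncomputable section

/-! ### The formal generating function of the `f_n` -/

variable {N : ℕ}

/-- The partial sum `m_k + ⋯ + m_N`. -/
def tail (m : Fin N → ℤ) (k : Fin N) : ℤ := ∑ i ∈ Finset.Ici k, m i

lemma tail_add (m m' : Fin N → ℤ) (k : Fin N) : tail (m + m') k = tail m k + tail m' k := by
  simp [tail, Finset.sum_add_distrib]

lemma tail_sub (m m' : Fin N → ℤ) (k : Fin N) : tail (m - m') k = tail m k - tail m' k := by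
  simp [tail, Finset.sum_sub_distrib]

lemma tail_smul (a : ℤ) (m : Fin N → ℤ) (k : Fin N) : tail (a • m) k = a * tail m k := by
  simp [tail, Finset.mul_sum]

lemma tail_single (j k : Fin N) : tail (Pi.single j 1) k = if k ≤ j then 1 else 0 := by
  simp [tail, Pi.single_apply, Finset.sum_ite_eq']

lemma tail_eq_add (m : Fin N → ℤ) (k : Fin N) :
    tail m k = m k + if h : (k : ℕ) + 1 < N then tail m ⟨k + 1, h⟩ else 0 := by
  have h1 : Finset.Ici k = insert k (Finset.Ioi k) := by simp
  rw [tail, h1, Finset.sum_insert (by simp)]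
  congr 1
  split_ifs with h
  · refine Finset.sum_congr ?_ fun _ _ => rfl
    ext i
    simp only [Finset.mem_Ioi, Finset.mem_Ici, Fin.lt_def, Fin.le_def]
    omega
  · refine Finset.sum_eq_zero fun i hi => ?_
    have := Fin.lt_def.mp (Finset.mem_Ioi.mp hi)
    omega

/-- The exponent of the monomial `∏ t_k ^ m_k` in the variables `t_1, t_2 / t_1, …, t_N / t_(N-1)`. -/
def tailExp (m : Fin N → ℤ) : Fin N →₀ ℕ := Finsupp.equivFunOnFinite.symm fun k => (tail m k).toNat

lemma tailExp_apply (m : Fin N → ℤ) (k : Fin N) : tailExp m k = (tail m k).toNat := rfl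

lemma tailExp_add {m m' : Fin N → ℤ} (h : ∀ k, 0 ≤ tail m k) (h' : ∀ k, 0 ≤ tail m' k) :
    tailExp (m + m') = tailExp m + tailExp m' := by
  ext k
  rw [Finsupp.add_apply, tailExp_apply, tailExp_apply, tailExp_apply, tail_add,
    Int.toNat_add (h k) (h' k)]

/-- The exponent of `t_k` in a monomial in `t_1, t_2 / t_1, …, t_N / t_(N-1)`. -/
def intWeight (k : Fin N) (b : Fin N →₀ ℕ) : ℤ :=
  (b k : ℤ) - if h : (k : ℕ) + 1 < N then (b ⟨k + 1, h⟩ : ℤ) else 0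

lemma intWeight_add (k : Fin N) (a b : Fin N →₀ ℕ) :
    intWeight k (a + b) = intWeight k a + intWeight k b := by
  unfold intWeight
  split_ifs
  · simp; ring
  · simp

lemma intWeight_zero (k : Fin N) : intWeight k 0 = 0 := by
  unfold intWeight
  split_ifs <;> simp

lemma intWeight_tailExp (k : Fin N) {m : Fin N → ℤ} (h : ∀ k, 0 ≤ tail m k) :
    intWeight k (tailExp m) = m k := by
  have h1 : ∀ i, ((tailExp m i : ℕ) : ℤ) = tail m i := fun i => by
    rw [tailExp_apply, Int.toNat_of_nonneg (h i)]
  unfold intWeight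
  rw [h1, tail_eq_add m k]
  split_ifs with h3
  · rw [h1]; ring
  · simp

lemma tail_intWeight (b : Fin N →₀ ℕ) (k : Fin N) : tail (fun i => intWeight i b) k = b k := by
  -- Induction on the distance of `k` from the end, since the weights telescope from the last index
  -- downwards.
  suffices h : ∀ d : ℕ, ∀ k : Fin N, N - (k : ℕ) = d → tail (fun i => intWeight i b) k = b k from
    h _ k rfl
  intro d
  induction d with
  | zero => intro k hk; have := k.2; omega
  | succ d ih =>
    intro k hk
    rw [tail_eq_add, intWeight]
    split_ifs with h
    · rw [ih ⟨k + 1, h⟩ (by simp; omega)]; ring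
    · ring

/-- The exponent of `t_k`, as a real number. -/
def expWeight (k : Fin N) (b : Fin N →₀ ℕ) : ℝ := intWeight k b

lemma expWeight_add (k : Fin N) (a b : Fin N →₀ ℕ) :
    expWeight k (a + b) = expWeight k a + expWeight k b := by
  simp [expWeight, intWeight_add]

lemma expWeight_tailExp (k : Fin N) {m : Fin N → ℤ} (h : ∀ k, 0 ≤ tail m k) :
    expWeight k (tailExp m) = m k := by
  rw [expWeight, intWeight_tailExp k h]

/-! ### Coefficient extraction and the derivations in `t` and `x` -/

/-- Power series in `t_1, t_2 / t_1, …, t_N / t_(N-1)` over the polynomials in `x_1, …, x_N`. -/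
abbrev Ser (N : ℕ) := MvPowerSeries (Fin N) (MvPolynomial (Fin N) ℝ)

/-- The monomial `∏ t_k ^ c_k`. -/
def mono (c : Fin N → ℤ) : Ser N := MvPowerSeries.monomial (tailExp c) 1

lemma mono_mul {c c' : Fin N → ℤ} (h : ∀ k, 0 ≤ tail c k) (h' : ∀ k, 0 ≤ tail c' k) :
    mono c * mono c' = mono (c + c') := by
  rw [mono, mono, mono, MvPowerSeries.monomial_mul_monomial, tailExp_add h h', one_mul]

lemma constantCoeff_mono {c : Fin N → ℤ} {k : Fin N} (h : 0 < tail c k) :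
    MvPowerSeries.constantCoeff (mono c) = 0 := by
  classical
  rw [← MvPowerSeries.coeff_zero_eq_constantCoeff_apply, mono, MvPowerSeries.coeff_monomial,
    if_neg]
  intro e
  have := DFunLike.congr_fun e k
  rw [tailExp_apply] at this
  simp at this
  omega

/-- The coefficient of `∏ t_k ^ m_k`. -/
def coeffAt (m : Fin N → ℤ) : Ser N →ₗ[ℝ] MvPolynomial (Fin N) ℝ :=
  if ∀ k, 0 ≤ tail m k then
    { toFun := fun G => MvPowerSeries.coeff (tailExp m) G
      map_add' := fun G G' => map_add _ G G'
      map_smul' := fun _ _ => rfl }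
  else 0

lemma coeffAt_of_nonneg {m : Fin N → ℤ} (h : ∀ k, 0 ≤ tail m k) (G : Ser N) :
    coeffAt m G = MvPowerSeries.coeff (tailExp m) G := by
  rw [coeffAt, if_pos h]
  rfl

lemma coeffAt_of_neg {m : Fin N → ℤ} (h : ∃ k, tail m k < 0) (G : Ser N) :
    coeffAt m G = 0 := by
  rw [coeffAt, if_neg (by push Not; exact h), LinearMap.zero_apply]

lemma coeffAt_C_mul (m : Fin N → ℤ) (p : MvPolynomial (Fin N) ℝ) (G : Ser N) :
    coeffAt m (MvPowerSeries.C p * G) = p * coeffAt m G := by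
  by_cases h : ∀ k, 0 ≤ tail m k
  · rw [coeffAt_of_nonneg h, coeffAt_of_nonneg h, MvPowerSeries.coeff_C_mul]
  · push Not at h
    rw [coeffAt_of_neg h, coeffAt_of_neg h, mul_zero]

/-- Because `coeffAt` is zero outside the cone of nonnegative tails, the shift needs no condition on
`m - c`. This is how multiplication by monomials in `t` becomes a shift of the index of `f_m`. -/
lemma coeffAt_mono_mul (m : Fin N → ℤ) {c : Fin N → ℤ} (hc : ∀ k, 0 ≤ tail c k) (G : Ser N) :
    coeffAt m (mono c * G) = coeffAt (m - c) G := by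
  classical
  by_cases h : ∀ k, 0 ≤ tail (m - c) k
  · have hm : ∀ k, 0 ≤ tail m k := fun k => by
      have := h k; rw [tail_sub] at this; have := hc k; omega
    rw [coeffAt_of_nonneg hm, coeffAt_of_nonneg h, mono]
    have e : tailExp m = tailExp c + tailExp (m - c) := by
      rw [← tailExp_add hc h, add_sub_cancel]
    rw [e, MvPowerSeries.coeff_add_monomial_mul, one_mul]
  · push Not at h
    rw [coeffAt_of_neg h]
    by_cases hm : ∀ k, 0 ≤ tail m k
    · rw [coeffAt_of_nonneg hm, mono, MvPowerSeries.coeff_monomial_mul, if_neg]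
      obtain ⟨k, hk⟩ := h
      intro hle
      have := hle k
      rw [tailExp_apply, tailExp_apply] at this
      rw [tail_sub] at hk
      have := hc k
      have := hm k
      omega
    · push Not at hm
      rw [coeffAt_of_neg hm]

lemma expWeight_leibniz (k : Fin N) (a b : Fin N →₀ ℕ) (u v : MvPolynomial (Fin N) ℝ) :
    (expWeight k (a + b) • (LinearMap.id : MvPolynomial (Fin N) ℝ →ₗ[ℝ] _)) (u * v) =
      u * (expWeight k b • (LinearMap.id : MvPolynomial (Fin N) ℝ →ₗ[ℝ] _)) v +
        v * (expWeight k a • (LinearMap.id : MvPolynomial (Fin N) ℝ →ₗ[ℝ] _)) u := by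
  simp only [LinearMap.smul_apply, LinearMap.id_apply, expWeight_add]
  simp only [Algebra.smul_def, map_add]
  ring

/-- The derivation `t_k ∂ / ∂ t_k`. -/
def theta (k : Fin N) : Derivation ℝ (Ser N) (Ser N) :=
  coeffDerivation (fun b => expWeight k b • LinearMap.id) (expWeight_leibniz k)

/-- The derivation `∂ / ∂ x_i`, acting on coefficients. -/
def dx (i : Fin N) : Derivation ℝ (Ser N) (Ser N) :=
  coeffDerivation (fun _ => (MvPolynomial.pderiv i).toLinearMap) fun a b u v => by
    simp [Derivation.leibniz]

lemma coeff_theta (k : Fin N) (G : Ser N) (b : Fin N →₀ ℕ) :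
    MvPowerSeries.coeff b (theta k G) = expWeight k b • MvPowerSeries.coeff b G := rfl

lemma coeff_dx (k : Fin N) (G : Ser N) (b : Fin N →₀ ℕ) :
    MvPowerSeries.coeff b (dx k G) = MvPolynomial.pderiv k (MvPowerSeries.coeff b G) := rfl

lemma coeffAt_theta (m : Fin N → ℤ) (k : Fin N) (G : Ser N) :
    coeffAt m (theta k G) = (m k : ℝ) • coeffAt m G := by
  by_cases h : ∀ k, 0 ≤ tail m k
  · rw [coeffAt_of_nonneg h, coeffAt_of_nonneg h, coeff_theta, expWeight_tailExp k h]
  · push Not at h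
    rw [coeffAt_of_neg h, coeffAt_of_neg h, smul_zero]

lemma coeffAt_dx (m : Fin N → ℤ) (k : Fin N) (G : Ser N) :
    coeffAt m (dx k G) = MvPolynomial.pderiv k (coeffAt m G) := by
  by_cases h : ∀ k, 0 ≤ tail m k
  · rw [coeffAt_of_nonneg h, coeffAt_of_nonneg h, coeff_dx]
  · push Not at h
    rw [coeffAt_of_neg h, coeffAt_of_neg h, map_zero]

lemma theta_mono (k : Fin N) {c : Fin N → ℤ} (hc : ∀ k, 0 ≤ tail c k) :
    theta k (mono c) = (c k : ℝ) • mono c := by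
  classical
  ext1 b
  change _ = (c k : ℝ) • MvPowerSeries.coeff b (mono c)
  rw [coeff_theta, mono, MvPowerSeries.coeff_monomial]
  split_ifs with h
  · rw [h, expWeight_tailExp k hc]
  · simp

lemma dx_mono (i : Fin N) (c : Fin N → ℤ) : dx i (mono c) = 0 := by
  classical
  ext1 b
  rw [coeff_dx, mono, MvPowerSeries.coeff_monomial]
  split_ifs <;> simp

lemma theta_C (k : Fin N) (p : MvPolynomial (Fin N) ℝ) : theta k (MvPowerSeries.C p) = 0 := by
  classical
  ext1 b
  rw [coeff_theta, MvPowerSeries.coeff_C]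
  split_ifs with h
  · subst h; simp [expWeight, intWeight_zero]
  · simp

lemma dx_C (i : Fin N) (p : MvPolynomial (Fin N) ℝ) :
    dx i (MvPowerSeries.C p) = MvPowerSeries.C (MvPolynomial.pderiv i p) := by
  classical
  ext1 b
  rw [coeff_dx, MvPowerSeries.coeff_C, MvPowerSeries.coeff_C]
  split_ifs <;> simp

/-- The variable `t_k = 1 / y_k`. -/
def tvar (k : Fin N) : Ser N := mono (Pi.single k 1)

/-- The quotient `t_k / t_j`, for `j < k`. -/
def ratio (j k : Fin N) : Ser N := mono (Pi.single k 1 - Pi.single j 1)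

/-- The product `x_j t_k`. -/
def xt (j k : Fin N) : Ser N := MvPowerSeries.C (MvPolynomial.X j) * tvar k

lemma tail_single_nonneg (j k : Fin N) : 0 ≤ tail (Pi.single j 1) k := by
  rw [tail_single]; split_ifs <;> simp

lemma tail_single_sub_nonneg {j k : Fin N} (h : j ≤ k) (i : Fin N) :
    0 ≤ tail (Pi.single k 1 - Pi.single j 1) i := by
  rw [tail_sub, tail_single, tail_single]
  split_ifs with h1 h2 h2
  · simp
  · simp
  · exact absurd (h2.trans h) h1
  · simp

lemma constantCoeff_ratio {j k : Fin N} (h : j < k) :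
    MvPowerSeries.constantCoeff (ratio j k) = 0 :=
  constantCoeff_mono (k := k) (by
    rw [tail_sub, tail_single, tail_single, if_pos le_rfl, if_neg (not_le.mpr h)]; simp)

lemma constantCoeff_tvar (k : Fin N) : MvPowerSeries.constantCoeff (tvar k) = 0 :=
  constantCoeff_mono (k := k) (by rw [tail_single]; simp)

lemma constantCoeff_xt (j k : Fin N) : MvPowerSeries.constantCoeff (xt j k) = 0 := by
  rw [xt, map_mul, constantCoeff_tvar, mul_zero]

lemma tvar_mul_ratio {j k : Fin N} (h : j < k) : tvar j * ratio j k = tvar k := by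
  rw [tvar, ratio, mono_mul (tail_single_nonneg j) (tail_single_sub_nonneg h.le), add_sub_cancel,
    tvar]

lemma theta_tvar (k j : Fin N) : theta k (tvar j) = if k = j then tvar j else 0 := by
  rw [tvar, theta_mono _ (tail_single_nonneg j), Pi.single_apply]
  split_ifs <;> simp

lemma theta_ratio (i : Fin N) {j k : Fin N} (h : j < k) :
    theta i (ratio j k) =
      (if i = k then ratio j k else 0) - (if i = j then ratio j k else 0) := by
  rw [ratio, theta_mono _ (tail_single_sub_nonneg h.le), Pi.sub_apply, Pi.single_apply,
    Pi.single_apply]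
  push_cast
  rw [sub_smul]
  split_ifs <;> simp

lemma theta_xt (i j k : Fin N) : theta i (xt j k) = if i = k then xt j k else 0 := by
  rw [xt, Derivation.leibniz, theta_C, theta_tvar]
  split_ifs <;> simp

lemma dx_xt (i j k : Fin N) : dx i (xt j k) = if i = j then tvar k else 0 := by
  rw [xt, Derivation.leibniz, dx_C, tvar, dx_mono, MvPolynomial.pderiv_X, Pi.single_apply]
  by_cases h : i = j
  · subst h; simp
  · have h' : j ≠ i := fun e => h e.symm
    simp [h, h']

/-! ### Poles, expanded fractions and their three-term identities -/

/-- `1 / (1 - x_j t_k)`. -/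
def pole (j k : Fin N) : Ser N := geomInv (xt j k)

/-- `t_l / (t_k - t_l)`, expanded in the region `t_1 ≫ t_2 ≫ ⋯`. -/
def expFrac (k l : Fin N) : Ser N :=
  if k < l then ratio k l * geomInv (ratio k l) else if l < k then -geomInv (ratio l k) else 0

lemma expFrac_self (k : Fin N) : expFrac k k = 0 := by simp [expFrac]

lemma one_sub_mul_pole (j k : Fin N) : (1 - xt j k) * pole j k = 1 :=
  one_sub_mul_geomInv (constantCoeff_xt j k)

/-- Both orderings of `k` and `l` satisfy the same equation. Since the series ring is a domain, this
equation determines `expFrac`, and later identities follow by multiplying with `t_k - t_l`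
regardless of the order. -/
lemma sub_mul_expFrac {k l : Fin N} (h : k ≠ l) :
    (tvar k - tvar l) * expFrac k l = tvar l := by
  unfold expFrac
  rcases lt_or_gt_of_ne h with h | h
  · rw [if_pos h]
    have h1 := one_sub_mul_geomInv (constantCoeff_ratio h)
    rw [← tvar_mul_ratio h]
    linear_combination tvar k * ratio k l * h1
  · rw [if_neg (not_lt.mpr h.le), if_pos h]
    have h1 := one_sub_mul_geomInv (constantCoeff_ratio h)
    rw [← tvar_mul_ratio h]
    linear_combination tvar l * h1

lemma tvar_ne_zero (k : Fin N) : tvar k ≠ 0 := by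
  intro h
  have := congrArg (MvPowerSeries.coeff (tailExp (Pi.single k 1))) h
  rw [tvar, mono, MvPowerSeries.coeff_monomial_same] at this
  simp at this

lemma tvar_sub_ne_zero {k l : Fin N} (h : k ≠ l) : tvar k - tvar l ≠ 0 := by
  intro e
  have := sub_mul_expFrac h
  rw [e, zero_mul] at this
  exact tvar_ne_zero l this.symm

/-- Partial fractions: with `p_k = 1/(1 - x t_k)` one has `t_k p_k - t_l p_l = (t_k - t_l) p_k p_l`.
-/
lemma expFrac_mul_pole {k l : Fin N} (h : k ≠ l) (i : Fin N) :
    tvar k * tvar l * (pole i k * pole i l) =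
      tvar k ^ 2 * expFrac k l * pole i k + tvar l ^ 2 * expFrac l k * pole i l := by
  apply mul_left_cancel₀ (tvar_sub_ne_zero h)
  have h1 := sub_mul_expFrac h
  have h2 := sub_mul_expFrac h.symm
  have h3 := one_sub_mul_pole i k
  have h4 := one_sub_mul_pole i l
  unfold xt at h3 h4
  linear_combination (-tvar k ^ 2 * pole i k) * h1 + (tvar l ^ 2 * pole i l) * h2 +
    tvar k ^ 2 * tvar l * pole i k * h4 - tvar l ^ 2 * tvar k * pole i l * h3

/-- After the common factor `t_k t_l t_m` is removed, this is the second divided difference of the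
function `t ↦ t`, which is zero. -/
lemma expFrac_cyclic {k l m : Fin N} (h1 : k ≠ l) (h2 : k ≠ m) (h3 : l ≠ m) :
    tvar k ^ 2 * expFrac k l * expFrac k m + tvar l ^ 2 * expFrac l k * expFrac l m +
      tvar m ^ 2 * expFrac m k * expFrac m l = 0 := by
  apply mul_left_cancel₀ (mul_ne_zero (mul_ne_zero (tvar_sub_ne_zero h1) (tvar_sub_ne_zero h2))
    (tvar_sub_ne_zero h3))
  have e1 := sub_mul_expFrac h1
  have e2 := sub_mul_expFrac h2
  have e3 := sub_mul_expFrac h3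
  have e4 := sub_mul_expFrac h1.symm
  have e5 := sub_mul_expFrac h2.symm
  have e6 := sub_mul_expFrac h3.symm
  linear_combination
    tvar k ^ 2 * (tvar l - tvar m) * (expFrac k m * (tvar k - tvar m) * e1 + tvar l * e2) -
    tvar l ^ 2 * (tvar k - tvar m) * (expFrac l m * (tvar l - tvar m) * e4 + tvar k * e3) +
    tvar m ^ 2 * (tvar k - tvar l) * (expFrac m l * (tvar m - tvar l) * e5 + tvar k * e6)

lemma tvar_mul_expFrac {k l : Fin N} (h : k < l) :
    tvar k * expFrac k l = tvar l * geomInv (ratio k l) := by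
  rw [expFrac, if_pos h, ← mul_assoc, tvar_mul_ratio h]

lemma tvar_mul_expFrac' {k l : Fin N} (h : k < l) :
    tvar l * expFrac l k = -(tvar l * geomInv (ratio k l)) := by
  rw [expFrac, if_neg (not_lt.mpr h.le), if_pos h, mul_neg]

lemma theta_expFrac {k l : Fin N} (h : k ≠ l) :
    theta k (expFrac k l) + expFrac k l = -expFrac k l ^ 2 := by
  have h1 := congrArg (theta k) (sub_mul_expFrac h)
  have h2 := sub_mul_expFrac h
  rw [Derivation.leibniz, map_sub, theta_tvar, theta_tvar, if_pos rfl, if_neg h, smul_eq_mul,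
    smul_eq_mul, sub_zero] at h1
  apply mul_left_cancel₀ (tvar_sub_ne_zero h)
  linear_combination h1 + expFrac k l * h2

lemma theta_pole (i k : Fin N) : theta k (pole i k) + pole i k = pole i k ^ 2 := by
  have h := one_sub_mul_pole i k
  rw [pole, derivation_geomInv _ (constantCoeff_xt i k), theta_xt, if_pos rfl, ← pole]
  linear_combination -pole i k * h

/-- `∏_{j < k} (1 - t_k / t_j) ^ λ * ∏_{j, k} (1 - x_j t_k) ^ (-λ)`. -/
def genSeries (lam : ℝ) : Ser N :=
  (∏ j : Fin N, ∏ k ∈ Finset.Ioi j, binSeries lam (ratio j k)) *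
    ∏ j : Fin N, ∏ k : Fin N, binSeries (-lam) (xt j k)

/-- The logarithmic derivative of a product of binomial series, for an arbitrary coefficientwise
derivation, so that it serves `dx` and `theta` alike. -/
lemma coeffDerivation_genSeries (lam : ℝ) (d) (hd) :
    coeffDerivation d hd (genSeries (N := N) lam) =
      ((∑ j : Fin N, ∑ k ∈ Finset.Ioi j,
          -(lam • (geomInv (ratio j k) * coeffDerivation d hd (ratio j k)))) +
        ∑ j : Fin N, ∑ k : Fin N, lam • (pole j k * coeffDerivation d hd (xt j k))) *
        genSeries lam := by
  have h1 := derivation_prod (coeffDerivation d hd) Finset.univ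
    (fun j : Fin N => ∏ k ∈ Finset.Ioi j, binSeries lam (ratio j k)) _ fun j _ =>
      derivation_prod (coeffDerivation d hd) (Finset.Ioi j) (fun k => binSeries lam (ratio j k)) _
        fun k hk => coeffDerivation_binSeries_eq d hd lam
          (constantCoeff_ratio (Finset.mem_Ioi.mp hk))
  have h2 := derivation_prod (coeffDerivation d hd) Finset.univ
    (fun j : Fin N => ∏ k : Fin N, binSeries (-lam) (xt j k)) _ fun j _ =>
      derivation_prod (coeffDerivation d hd) Finset.univ (fun k => binSeries (-lam) (xt j k)) _
        fun k hk => coeffDerivation_binSeries_eq d hd (-lam) (constantCoeff_xt j k)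
  rw [genSeries, Derivation.leibniz, h1, h2]
  simp only [neg_smul, neg_neg, smul_eq_mul, pole]
  ring

lemma dx_genSeries (lam : ℝ) (i : Fin N) :
    dx i (genSeries lam) = (lam • ∑ k, tvar k * pole i k) * genSeries lam := by
  have h := coeffDerivation_genSeries (N := N) lam
    (fun _ => (MvPolynomial.pderiv i).toLinearMap) (fun a b u v => by simp [Derivation.leibniz])
  change dx i (genSeries lam) = (_ + ∑ j : Fin N, ∑ k : Fin N, lam • (pole j k * dx i (xt j k))) * _
    at h
  rw [h]
  congr 1
  have h1 : ∀ j k : Fin N, coeffDerivation (fun _ => (MvPolynomial.pderiv i).toLinearMap)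
      (fun a b u v => by simp [Derivation.leibniz]) (ratio j k) = 0 := fun j k => dx_mono i _
  simp only [h1, dx_xt, mul_zero, smul_zero, neg_zero, Finset.sum_const_zero, zero_add]
  rw [Finset.smul_sum, Finset.sum_eq_single i]
  · simp [mul_comm]
  · intro j _ hj
    simp [hj.symm]
  · simp

/-- The logarithmic derivative of the generating function in `t_k`, up to normalization. -/
def logDer (k : Fin N) : Ser N := ∑ j, pole j k + ∑ l, expFrac k l

/-- The constant collects the `-1`s from `x t p = p - 1` (there are `N`) and from `r/(1-r) = 1/(1-r)
- 1` (one for each index below `i`). As `i` starts at 0, `λ (N - i)` is the shift in `m̃`. -/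
lemma theta_genSeries (lam : ℝ) (i : Fin N) :
    theta i (genSeries lam) + (lam * (N - i)) • genSeries lam =
      lam • (logDer i * genSeries lam) := by
  have h := coeffDerivation_genSeries (N := N) lam
    (fun b => expWeight i b • LinearMap.id) (expWeight_leibniz i)
  change theta i (genSeries lam) = ((∑ j : Fin N, ∑ k ∈ Finset.Ioi j,
          -(lam • (geomInv (ratio j k) * theta i (ratio j k)))) +
        ∑ j : Fin N, ∑ k : Fin N, lam • (pole j k * theta i (xt j k))) * _ at h
  have h1 : ∑ j : Fin N, ∑ k : Fin N, pole j k * theta i (xt j k) = ∑ j, pole j i - (N : Ser N) := by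
    have : ∀ j : Fin N, ∑ k : Fin N, pole j k * theta i (xt j k) = pole j i - 1 := fun j => by
      rw [Finset.sum_eq_single i]
      · rw [theta_xt, if_pos rfl]
        linear_combination -one_sub_mul_pole j i
      · intro k _ hk
        simp [theta_xt, hk.symm]
      · simp
    simp [this]
  -- Pairs `(i, k)` with `k` above `i` contribute `-expFrac i k`, and pairs `(j, i)` with `j` below
  -- `i` contribute `-expFrac i j - 1`.
  have h2 : ∑ j : Fin N, ∑ k ∈ Finset.Ioi j, geomInv (ratio j k) * theta i (ratio j k) =
      -∑ l, expFrac i l - (i : ℕ) := by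
    have e1 : ∀ j : Fin N, ∑ k ∈ Finset.Ioi j, geomInv (ratio j k) * theta i (ratio j k) =
        (if j < i then geomInv (ratio j i) - 1 else 0) -
          if i = j then ∑ k, if j < k then expFrac i k else 0 else 0 := fun j => by
      have e2 : ∀ k ∈ Finset.Ioi j, geomInv (ratio j k) * theta i (ratio j k) =
          (if i = k then geomInv (ratio j i) - 1 else 0) - if i = j then expFrac i k else 0 := by
        intro k hk
        have hk := Finset.mem_Ioi.mp hk
        rw [theta_ratio i hk]
        have h3 := one_sub_mul_geomInv (constantCoeff_ratio hk)
        by_cases h4 : i = k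
        · subst h4
          rw [if_pos rfl, if_neg hk.ne', if_pos rfl, if_neg hk.ne']
          linear_combination -h3
        · rw [if_neg h4, if_neg h4]
          split_ifs with h5
          · subst h5
            rw [expFrac, if_pos hk]; ring
          · simp
      rw [Finset.sum_congr rfl e2, Finset.sum_sub_distrib]
      congr 1
      · simp
      · split_ifs
        · rw [← Finset.sum_filter]; congr 1; ext; simp
        · simp
    rw [Finset.sum_congr rfl fun j _ => e1 j, Finset.sum_sub_distrib, Finset.sum_ite_eq,
      if_pos (Finset.mem_univ _)]
    have e3 : ∑ l, expFrac i l = (∑ k, if i < k then expFrac i k else 0) -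
        ∑ j, if j < i then geomInv (ratio j i) else 0 := by
      rw [← Finset.sum_sub_distrib]
      refine Finset.sum_congr rfl fun l _ => ?_
      rcases lt_trichotomy i l with h | h | h
      · simp [h, h.not_gt]
      · subst h; simp [expFrac_self]
      · simp [h, h.not_gt, expFrac]
    have e4 : ∑ j : Fin N, (if j < i then geomInv (ratio j i) - 1 else 0) =
        (∑ j, if j < i then geomInv (ratio j i) else 0) - ((i : ℕ) : Ser N) := by
      have : ((i : ℕ) : Ser N) = ∑ j : Fin N, if j < i then 1 else 0 := by
        rw [← Finset.sum_filter, Finset.sum_const, nsmul_eq_mul, mul_one]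
        congr 1
        rw [show Finset.univ.filter (fun j => j < i) = Finset.Iio i by ext; simp, Fin.card_Iio]
      rw [this, ← Finset.sum_sub_distrib]
      refine Finset.sum_congr rfl fun l _ => ?_
      split_ifs <;> simp
    rw [e3, e4]
    ring
  simp only [Finset.sum_neg_distrib, ← Finset.smul_sum] at h
  rw [h1, h2] at h
  rw [h, logDer]
  simp only [Algebra.smul_def, map_mul, map_sub, map_natCast]
  ring

end

noncomputable section

/-! ### The differential equation of the generating function -/

variable {N : ℕ}

lemma sum_sum_eq_diag_add_two_mul {A : Type*} [CommRing A] (s : Fin N → Fin N → A)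
    (h : ∀ i j, s i j = s j i) :
    ∑ i, ∑ j, s i j = ∑ i, s i i + 2 * ∑ i, ∑ j ∈ Finset.Ioi i, s i j := by
  have h1 : ∀ i : Fin N, ∑ j ∈ Finset.Ioi i, s i j = ∑ j, if i < j then s i j else 0 := fun i => by
    rw [← Finset.sum_filter]; congr 1; ext; simp
  have h2 : ∑ i, ∑ j, (if i < j then s i j else 0) = ∑ i, ∑ j, if j < i then s i j else 0 := by
    rw [Finset.sum_comm]
    refine Finset.sum_congr rfl fun i _ => Finset.sum_congr rfl fun j _ => ?_
    rw [h i j]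
  simp only [h1]
  rw [two_mul]
  nth_rw 2 [h2]
  rw [← Finset.sum_add_distrib, ← Finset.sum_add_distrib]
  refine Finset.sum_congr rfl fun i _ => ?_
  have h3 : s i i = ∑ j, if i = j then s i j else 0 := by simp
  rw [h3, ← Finset.sum_add_distrib, ← Finset.sum_add_distrib]
  refine Finset.sum_congr rfl fun j _ => ?_
  rcases lt_trichotomy i j with h | h | h
  · simp [h, h.ne, h.not_gt]
  · subst h; simp
  · simp [h, h.ne', h.not_gt]

instance : CharZero (Ser N) :=
  charZero_of_injective_algebraMap (algebraMap ℝ (Ser N)).injective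

/-- The algebraic core. Expanding the first squares by `expFrac_mul_pole` gives pole squares, which
cancel, and the cross terms of `logDer k ^ 2`. The missing squares of `∑ l, expFrac k l` have no
mixed terms in total, by `expFrac_cyclic`. -/
lemma sum_sq_poles :
    ∑ i : Fin N, (∑ k, tvar k * pole i k) ^ 2 +
        ∑ k, tvar k ^ 2 * ((∑ i, pole i k) ^ 2 - ∑ i, pole i k ^ 2) =
      ∑ k, tvar k ^ 2 * logDer k ^ 2 - ∑ k : Fin N, ∑ l, tvar k ^ 2 * expFrac k l ^ 2 := by
  have h1 := sum_mul_sq_sum_of_cyclic (fun k : Fin N => tvar k ^ 2) expFrac expFrac_self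
    fun k l m => expFrac_cyclic
  have h2 : ∀ i k l : Fin N, tvar k * pole i k * (tvar l * pole i l) =
      (if k = l then tvar k ^ 2 * pole i k ^ 2 else 0) +
        (tvar k ^ 2 * expFrac k l * pole i k + tvar l ^ 2 * expFrac l k * pole i l) := by
    intro i k l
    split_ifs with h
    · subst h; rw [expFrac_self]; ring
    · rw [← expFrac_mul_pole h]; ring
  have h3 : ∀ i : Fin N, (∑ k, tvar k * pole i k) ^ 2 = ∑ k, tvar k ^ 2 * pole i k ^ 2 +
      2 * ∑ k, ∑ l, tvar k ^ 2 * expFrac k l * pole i k := by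
    intro i
    rw [sq, Finset.sum_mul_sum]
    simp only [h2, Finset.sum_add_distrib, Finset.sum_ite_eq, Finset.mem_univ, if_true]
    rw [Finset.sum_comm (f := fun x y => tvar y ^ 2 * expFrac y x * pole i y)]
    ring
  have h4 : ∑ i : Fin N, ∑ k, ∑ l, tvar k ^ 2 * expFrac k l * pole i k =
      ∑ k, tvar k ^ 2 * ((∑ i, pole i k) * ∑ l, expFrac k l) := by
    rw [Finset.sum_comm]
    refine Finset.sum_congr rfl fun k _ => ?_
    rw [Finset.sum_mul_sum, Finset.mul_sum]
    refine Finset.sum_congr rfl fun i _ => ?_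
    rw [Finset.mul_sum]
    exact Finset.sum_congr rfl fun l _ => by ring
  have h5 : ∑ i : Fin N, ∑ k, tvar k ^ 2 * pole i k ^ 2 =
      ∑ k, tvar k ^ 2 * ∑ i, pole i k ^ 2 := by
    rw [Finset.sum_comm]
    exact Finset.sum_congr rfl fun k _ => (Finset.mul_sum _ _ _).symm
  simp only [h3, Finset.sum_add_distrib]
  rw [← Finset.mul_sum, h4, h5, ← h1, Finset.mul_sum, ← Finset.sum_add_distrib,
    ← Finset.sum_add_distrib, ← Finset.sum_sub_distrib]
  refine Finset.sum_congr rfl fun k _ => ?_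
  rw [logDer]
  ring

lemma dx_dx_genSeries (lam : ℝ) (i : Fin N) :
    dx i (dx i (genSeries lam)) =
      (algebraMap ℝ (Ser N) lam ^ 2 * (∑ k, tvar k * pole i k) ^ 2 +
        algebraMap ℝ (Ser N) lam * ∑ k, tvar k ^ 2 * pole i k ^ 2) * genSeries lam := by
  have h1 : ∀ k, dx i (tvar k * pole i k) = tvar k ^ 2 * pole i k ^ 2 := fun k => by
    rw [Derivation.leibniz, pole, derivation_geomInv _ (constantCoeff_xt i k), dx_xt, if_pos rfl,
      tvar, dx_mono, smul_zero, add_zero, smul_eq_mul]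
    ring
  rw [dx_genSeries, Derivation.leibniz, dx_genSeries, Derivation.map_smul, map_sum]
  simp only [h1, smul_eq_mul]
  simp only [Algebra.smul_def]
  ring

/-- A Riccati equation, inherited from those of the individual summands. -/
lemma theta_logDer (k : Fin N) :
    theta k (logDer k) + logDer k = ∑ j, pole j k ^ 2 - ∑ l, expFrac k l ^ 2 := by
  have h1 : ∀ l, theta k (expFrac k l) + expFrac k l = -expFrac k l ^ 2 := fun l => by
    by_cases h : k = l
    · subst h; simp [expFrac_self]
    · exact theta_expFrac h
  rw [logDer, map_add, map_sum, map_sum, add_add_add_comm, ← Finset.sum_add_distrib,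
    ← Finset.sum_add_distrib]
  simp only [theta_pole, h1, Finset.sum_neg_distrib]
  ring

/-- The extra 1 in the second factor is what turns `theta k (logDer k)` into the left side of
`theta_logDer`. It is the origin of `m̃ (m̃ + 1)` in `g`. -/
lemma theta_theta_genSeries (lam : ℝ) (k : Fin N) :
    theta k (theta k (genSeries lam) + (lam * (N - k)) • genSeries lam) +
      (lam * (N - k) + 1) • (theta k (genSeries lam) + (lam * (N - k)) • genSeries lam) =
      (algebraMap ℝ (Ser N) lam ^ 2 * logDer k ^ 2 +
        algebraMap ℝ (Ser N) lam * (∑ j, pole j k ^ 2 - ∑ l, expFrac k l ^ 2)) *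
          genSeries lam := by
  have h := theta_genSeries lam k
  rw [h, Derivation.map_smul, Derivation.leibniz, ← theta_logDer]
  simp only [smul_eq_mul] at h ⊢
  simp only [Algebra.smul_def, map_add, map_one] at h ⊢
  linear_combination algebraMap ℝ (Ser N) lam * logDer k * h

/-- The quotient of `(∂_i - ∂_j) F` by `x_i - x_j`, for the generating function `F`. -/
def dxQuot (lam : ℝ) (i j : Fin N) : Ser N :=
  algebraMap ℝ (Ser N) lam * (∑ k, tvar k ^ 2 * (pole i k * pole j k)) * genSeries lam

/-- The difference of two poles at the same `t_k` is divisible by `x_i - x_j`. The quotient is thus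
available inside the series ring, and its coefficients are polynomials. -/
lemma sub_mul_dxQuot (lam : ℝ) (i j : Fin N) :
    MvPowerSeries.C (MvPolynomial.X i - MvPolynomial.X j) * dxQuot lam i j =
      dx i (genSeries lam) - dx j (genSeries lam) := by
  have h : ∀ k : Fin N, MvPowerSeries.C (MvPolynomial.X i - MvPolynomial.X j) *
      (tvar k ^ 2 * (pole i k * pole j k)) = tvar k * pole i k - tvar k * pole j k := fun k => by
    have h1 := one_sub_mul_pole i k
    have h2 := one_sub_mul_pole j k
    unfold xt at h1 h2
    rw [map_sub]
    linear_combination tvar k * pole i k * h2 - tvar k * pole j k * h1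
  rw [dx_genSeries, dx_genSeries, dxQuot, Algebra.smul_def, Algebra.smul_def]
  have h3 : ∑ k : Fin N, tvar k * pole i k - ∑ k, tvar k * pole j k =
      MvPowerSeries.C (MvPolynomial.X i - MvPolynomial.X j) *
        ∑ k, tvar k ^ 2 * (pole i k * pole j k) := by
    rw [Finset.mul_sum, ← Finset.sum_sub_distrib]
    exact Finset.sum_congr rfl fun k _ => (h k).symm
  linear_combination -(algebraMap ℝ (Ser N) lam * genSeries lam) * h3

lemma sum_sum_sum_mul {A : Type*} [CommRing A] (t : Fin N → A) (X : Fin N → Fin N → A) :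
    ∑ i : Fin N, ∑ j : Fin N, ∑ k : Fin N, t k ^ 2 * (X i k * X j k) =
      ∑ k : Fin N, t k ^ 2 * (∑ i, X i k) ^ 2 := by
  have h : ∀ k : Fin N, t k ^ 2 * (∑ i, X i k) ^ 2 =
      ∑ i : Fin N, ∑ j : Fin N, t k ^ 2 * (X i k * X j k) := fun k => by
    rw [sq (∑ i, X i k), Finset.sum_mul_sum, Finset.mul_sum]
    exact Finset.sum_congr rfl fun i _ => Finset.mul_sum _ _ _
  rw [Finset.sum_congr rfl fun k _ => h k]
  symm
  rw [Finset.sum_comm]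
  exact Finset.sum_congr rfl fun i _ => Finset.sum_comm

lemma sum_sum_sq_mul {A : Type*} [CommRing A] (t : Fin N → A) (X : Fin N → Fin N → A) :
    ∑ i : Fin N, ∑ k : Fin N, t k ^ 2 * (X i k * X i k) =
      ∑ k : Fin N, t k ^ 2 * ∑ i, X i k ^ 2 := by
  rw [Finset.sum_comm]
  simp only [Finset.mul_sum, sq (X _ _)]

lemma two_mul_sum_dxQuot (lam : ℝ) :
    2 * ∑ i : Fin N, ∑ j ∈ Finset.Ioi i, dxQuot lam i j =
      algebraMap ℝ (Ser N) lam *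
        (∑ k, tvar k ^ 2 * ((∑ i : Fin N, pole i k) ^ 2 - ∑ i, pole i k ^ 2)) *
        genSeries lam := by
  have h := sum_sum_eq_diag_add_two_mul (fun i j : Fin N => dxQuot lam i j) fun i j => by
    simp only [dxQuot, mul_comm (pole i _)]
  have h1 : ∑ i : Fin N, ∑ j : Fin N, dxQuot lam i j = algebraMap ℝ (Ser N) lam *
      (∑ k, tvar k ^ 2 * (∑ i : Fin N, pole i k) ^ 2) * genSeries lam := by
    rw [← sum_sum_sum_mul, Finset.mul_sum, Finset.sum_mul]
    refine Finset.sum_congr rfl fun i _ => ?_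
    rw [Finset.mul_sum, Finset.sum_mul]
    simp only [dxQuot]
  have h2 : ∑ i : Fin N, dxQuot lam i i = algebraMap ℝ (Ser N) lam *
      (∑ k, tvar k ^ 2 * ∑ i : Fin N, pole i k ^ 2) * genSeries lam := by
    rw [← sum_sum_sq_mul, Finset.mul_sum, Finset.sum_mul]
    simp only [dxQuot]
  rw [h1, h2] at h
  simp only [mul_sub, Finset.sum_sub_distrib]
  linear_combination -h

/-- For `i < j` and `r = t_j/t_i` one has `t_i t_j r/(1-r)² = (t_i expFrac i j)²`, and this square
is symmetric in the pair because `t_i expFrac i j = -t_j expFrac j i`. -/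
lemma two_mul_sum_ratio (G : Ser N) :
    2 * ∑ i : Fin N, ∑ j ∈ Finset.Ioi i,
      tvar i * tvar j * (ratio i j * geomInv (ratio i j) ^ 2) * G =
      (∑ k : Fin N, ∑ l, tvar k ^ 2 * expFrac k l ^ 2) * G := by
  have h := sum_sum_eq_diag_add_two_mul (fun k l : Fin N => tvar k ^ 2 * expFrac k l ^ 2)
    fun i j => by
      rcases lt_trichotomy i j with h | h | h
      · rw [← mul_pow, ← mul_pow, tvar_mul_expFrac h, tvar_mul_expFrac' h, neg_sq]
      · rw [h]
      · rw [← mul_pow, ← mul_pow, tvar_mul_expFrac h, tvar_mul_expFrac' h, neg_sq]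
  have h0 : ∑ i : Fin N, tvar i ^ 2 * expFrac i i ^ 2 = 0 :=
    Finset.sum_eq_zero fun i _ => by rw [expFrac_self]; ring
  have h1 : ∑ i : Fin N, ∑ j ∈ Finset.Ioi i,
      tvar i * tvar j * (ratio i j * geomInv (ratio i j) ^ 2) * G =
      (∑ i : Fin N, ∑ j ∈ Finset.Ioi i, tvar i ^ 2 * expFrac i j ^ 2) * G := by
    rw [Finset.sum_mul]
    refine Finset.sum_congr rfl fun i _ => ?_
    rw [Finset.sum_mul]
    refine Finset.sum_congr rfl fun j hj => ?_
    rw [expFrac, if_pos (Finset.mem_Ioi.mp hj), ← tvar_mul_ratio (Finset.mem_Ioi.mp hj)]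
    ring
  rw [h, h0, zero_add, h1, mul_assoc]

/-- Both sides are multiples of the generating function, compared as polynomials in `λ`. The `λ²`
part is `sum_sq_poles`. In the linear part the pole squares agree, while the squares of `expFrac`
cancel against the linear part of `λ (λ - 1)`, which fixes that coupling. -/
lemma genSeries_pde (lam : ℝ) :
    ∑ i : Fin N, dx i (dx i (genSeries lam)) +
        (2 * lam) • ∑ i : Fin N, ∑ j ∈ Finset.Ioi i, dxQuot lam i j =
      ∑ k : Fin N, tvar k ^ 2 *
        (theta k (theta k (genSeries lam) + (lam * (N - k)) • genSeries lam) +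
          (lam * (N - k) + 1) • (theta k (genSeries lam) + (lam * (N - k)) • genSeries lam)) -
      (2 * lam * (lam - 1)) • ∑ i : Fin N, ∑ j ∈ Finset.Ioi i,
        tvar i * tvar j * (ratio i j * geomInv (ratio i j) ^ 2) * genSeries lam := by
  set L := algebraMap ℝ (Ser N) lam with hL
  have e1 : ∑ i : Fin N, dx i (dx i (genSeries lam)) =
      (L ^ 2 * ∑ i : Fin N, (∑ k, tvar k * pole i k) ^ 2 +
        L * ∑ k, tvar k ^ 2 * ∑ i : Fin N, pole i k ^ 2) * genSeries lam := by
    simp only [dx_dx_genSeries]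
    rw [← Finset.sum_mul, Finset.sum_add_distrib, ← Finset.mul_sum, ← Finset.mul_sum,
      Finset.sum_comm]
    simp only [Finset.mul_sum, ← hL]
  have e2 : 2 * ∑ i : Fin N, ∑ j ∈ Finset.Ioi i, dxQuot lam i j =
      L * (∑ k, tvar k ^ 2 * ((∑ i : Fin N, pole i k) ^ 2 - ∑ i, pole i k ^ 2)) *
        genSeries lam := two_mul_sum_dxQuot lam
  have e3 : ∑ k : Fin N, tvar k ^ 2 *
        (theta k (theta k (genSeries lam) + (lam * (N - k)) • genSeries lam) +
          (lam * (N - k) + 1) • (theta k (genSeries lam) + (lam * (N - k)) • genSeries lam)) =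
      (L ^ 2 * ∑ k : Fin N, tvar k ^ 2 * logDer k ^ 2 + L * (∑ k, tvar k ^ 2 * ∑ j : Fin N, pole j k ^ 2 -
        ∑ k : Fin N, ∑ l, tvar k ^ 2 * expFrac k l ^ 2)) * genSeries lam := by
    simp only [theta_theta_genSeries]
    rw [Finset.mul_sum, mul_sub, Finset.mul_sum, Finset.mul_sum, ← Finset.sum_sub_distrib,
      ← Finset.sum_add_distrib, Finset.sum_mul]
    refine Finset.sum_congr rfl fun k _ => ?_
    rw [← Finset.mul_sum]
    ring
  have e4 := two_mul_sum_ratio (genSeries (N := N) lam)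
  have key := sum_sq_poles (N := N)
  have c1 : algebraMap ℝ (Ser N) (2 * lam) = 2 * L := by rw [map_mul, map_ofNat]
  have c2 : algebraMap ℝ (Ser N) (2 * lam * (lam - 1)) = 2 * L * (L - 1) := by
    rw [map_mul, map_mul, map_ofNat, map_sub, map_one]
  rw [e1, e3, Algebra.smul_def, Algebra.smul_def, c1, c2]
  linear_combination L * e2 + L * (L - 1) * e4 + L ^ 2 * genSeries lam * key

/-- The generating function is unchanged under `x ↦ s x`, `t ↦ t / s`. In terms of logarithmic
derivatives, `expFrac k l + expFrac l k = -1` balances the constants `λ (N - k)`. -/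
lemma euler_genSeries (lam : ℝ) :
    ∑ i : Fin N, MvPowerSeries.C (MvPolynomial.X i) * dx i (genSeries lam) =
      ∑ k : Fin N, theta k (genSeries lam) := by
  have h1 : ∀ i, theta i (genSeries (N := N) lam) =
      algebraMap ℝ (Ser N) lam * logDer i * genSeries lam -
        algebraMap ℝ (Ser N) (lam * (N - i)) * genSeries lam := fun i => by
    have := theta_genSeries (N := N) lam i
    rw [Algebra.smul_def, Algebra.smul_def] at this
    linear_combination this
  have h2 : ∀ i k : Fin N, MvPowerSeries.C (MvPolynomial.X i) * (tvar k * pole i k) =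
      pole i k - 1 := fun i k => by
    have := one_sub_mul_pole i k
    unfold xt at this
    linear_combination -this
  have h3 : ∀ i : Fin N, MvPowerSeries.C (MvPolynomial.X i) * dx i (genSeries lam) =
      algebraMap ℝ (Ser N) lam * (∑ k, pole i k - (N : Ser N)) * genSeries lam := fun i => by
    have : MvPowerSeries.C (MvPolynomial.X i) * ∑ k : Fin N, tvar k * pole i k =
        ∑ k, pole i k - (N : Ser N) := by
      rw [Finset.mul_sum]; simp [h2]
    rw [dx_genSeries, Algebra.smul_def]
    linear_combination algebraMap ℝ (Ser N) lam * genSeries lam * this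
  have h4 : ∀ k l : Fin N, k ≠ l → expFrac k l + expFrac l k = -1 := fun k l h => by
    apply mul_left_cancel₀ (tvar_sub_ne_zero h)
    linear_combination sub_mul_expFrac h - sub_mul_expFrac h.symm
  have h5 : 2 * ∑ k : Fin N, ∑ l, expFrac k l = (N : Ser N) - (N : Ser N) ^ 2 := by
    have e1 : 2 * ∑ k : Fin N, ∑ l, expFrac k l =
        ∑ k : Fin N, ∑ l, (expFrac k l + expFrac l k) := by
      simp only [Finset.sum_add_distrib]
      rw [Finset.sum_comm (f := fun x y => expFrac y x)]
      ring
    have e2 : ∀ k l : Fin N, expFrac k l + expFrac l k = (if k = l then 1 else 0) - 1 :=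
      fun k l => by
        by_cases h : k = l
        · subst h; simp [expFrac_self]
        · rw [h4 k l h, if_neg h]; ring
    rw [e1]
    simp only [e2, Finset.sum_sub_distrib]
    simp [sq]
  have h6 : 2 * ∑ k : Fin N, ((N : ℝ) - k) = (N : ℝ) ^ 2 + N := by
    have e : ((∑ i ∈ Finset.range N, i : ℕ) : ℝ) * 2 = N * (N - 1) := by
      rcases Nat.eq_zero_or_pos N with h | h
      · subst h; simp
      · have := Finset.sum_range_id_mul_two N
        have h' := congrArg (Nat.cast : ℕ → ℝ) this
        push_cast [Nat.cast_sub (show 1 ≤ N from h)] at h'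
        push_cast
        linarith
    rw [Finset.sum_sub_distrib, Fin.sum_univ_eq_sum_range (fun k => (k : ℝ)) N]
    push_cast at e
    simp
    linarith
  have h7 : (2 : Ser N) * ∑ k : Fin N, algebraMap ℝ (Ser N) (lam * (N - k)) =
      algebraMap ℝ (Ser N) lam * ((N : Ser N) ^ 2 + N) := by
    rw [← map_sum, ← Finset.mul_sum]
    have := congrArg (algebraMap ℝ (Ser N)) h6
    rw [map_mul, map_add, map_pow, map_natCast, map_ofNat] at this
    rw [map_mul]
    linear_combination algebraMap ℝ (Ser N) lam * this
  simp only [h3, h1]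
  rw [← Finset.sum_mul, ← Finset.mul_sum, Finset.sum_sub_distrib, Finset.sum_sub_distrib,
    ← Finset.sum_mul, ← Finset.sum_mul, ← Finset.mul_sum]
  simp only [logDer, Finset.sum_add_distrib, Finset.sum_const, Finset.card_univ, Fintype.card_fin,
    nsmul_eq_mul]
  rw [Finset.sum_comm (f := fun x y => pole y x)]
  have two : (2 : Ser N) ≠ 0 := two_ne_zero
  apply mul_left_cancel₀ two
  linear_combination genSeries lam * h7 - algebraMap ℝ (Ser N) lam * genSeries lam * h5

end

noncomputable section

/-! ### The polynomials `f_n` and the action of the reduced Hamiltonian on them -/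

variable {N : ℕ}

/-- The polynomial `f_m`, a coefficient of the generating function. -/
def fPoly (lam : ℝ) (m : Fin N → ℤ) : MvPolynomial (Fin N) ℝ := coeffAt m (genSeries lam)

/-- The quotient of `(∂_i - ∂_j) f_m` by `x_i - x_j`. -/
def fQuot (lam : ℝ) (m : Fin N → ℤ) (i j : Fin N) : MvPolynomial (Fin N) ℝ :=
  coeffAt m (dxQuot lam i j)

lemma fPoly_of_neg (lam : ℝ) {m : Fin N → ℤ} (h : ∃ k, tail m k < 0) : fPoly lam m = 0 :=
  coeffAt_of_neg h _

lemma sub_mul_fQuot (lam : ℝ) (m : Fin N → ℤ) (i j : Fin N) :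
    (MvPolynomial.X i - MvPolynomial.X j) * fQuot lam m i j =
      MvPolynomial.pderiv i (fPoly lam m) - MvPolynomial.pderiv j (fPoly lam m) := by
  rw [fQuot, ← coeffAt_C_mul, sub_mul_dxQuot, map_sub, coeffAt_dx, coeffAt_dx]
  rfl

lemma euler_fPoly (lam : ℝ) (m : Fin N → ℤ) :
    ∑ i, MvPolynomial.X i * MvPolynomial.pderiv i (fPoly lam m) =
      (∑ i, (m i : ℝ)) • fPoly lam m := by
  have h := congrArg (coeffAt m) (euler_genSeries (N := N) lam)
  simp only [map_sum, coeffAt_C_mul, coeffAt_dx, coeffAt_theta, ← Finset.sum_smul] at h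
  exact h

lemma tail_shift_nonneg {i j : Fin N} (h : i ≤ j) (ν : ℕ) (k : Fin N) :
    0 ≤ tail (shift i j ν) k := by
  rw [shift, tail_add, tail_smul, tail_smul, tail_single, tail_single]
  split_ifs with h1 h2 h2
  · simp
  · exact absurd (h1.trans h) h2
  · simp; omega
  · simp

lemma tail_shift_of_lt {i j : Fin N} (h : i < j) (ν : ℕ) : tail (shift i j ν) j = 1 + ν := by
  rw [shift, tail_add, tail_smul, tail_smul, tail_single, tail_single, if_neg (not_le.mpr h),
    if_pos le_rfl]
  simp

lemma shift_self (i : Fin N) : shift i i 0 = (2 : ℤ) • Pi.single i 1 := by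
  rw [shift]; simp [two_smul]

lemma tvar_mul_mono_pow {i j : Fin N} (h : i < j) (ν : ℕ) :
    tvar i * tvar j * ratio i j ^ ν = mono (shift i j ν) := by
  have h1 : ratio i j ^ ν = mono ((ν : ℤ) • (Pi.single j 1 - Pi.single i 1)) ∧
      ∀ k, 0 ≤ tail ((ν : ℤ) • (Pi.single j 1 - Pi.single i 1)) k := by
    refine ⟨?_, fun k => ?_⟩
    · induction ν with
      | zero =>
        have : tailExp (0 : Fin N → ℤ) = 0 := by ext k; simp [tailExp_apply, tail]
        simp [mono, this]
      | succ ν ih =>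
        rw [pow_succ, ih, ratio, mono_mul _ (tail_single_sub_nonneg h.le)]
        · congr 1
          push_cast
          rw [add_smul, one_smul]
        · intro k
          rw [tail_smul]
          exact mul_nonneg (by positivity) (tail_single_sub_nonneg h.le k)
    · rw [tail_smul]
      exact mul_nonneg (by positivity) (tail_single_sub_nonneg h.le k)
  rw [h1.1, tvar, tvar, mono_mul (tail_single_nonneg i) (tail_single_nonneg j), mono_mul _ h1.2]
  · congr 1
    rw [shift, smul_sub, sub_smul, add_smul, one_smul, one_smul]
    abel
  · intro k
    rw [tail_add]
    exact add_nonneg (tail_single_nonneg i k) (tail_single_nonneg j k)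

/-- The expansion `r/(1-r)² = ∑ ν r^ν` with exact remainder, which avoids infinite sums of series.
-/
lemma mul_sq_eq_sum_add {A : Type*} [CommRing A] {r V : A} (h : (1 - r) * V = 1) (M : ℕ) :
    r * V ^ 2 = ∑ ν ∈ Finset.range M, (ν : A) * r ^ ν + r ^ M * ((M : A) * V + r * V ^ 2) := by
  induction M with
  | zero => simp
  | succ M ih =>
    refine ih.trans ?_
    rw [Finset.sum_range_succ]
    push_cast
    rw [pow_succ]
    linear_combination (r ^ M * (M + r * V)) * h

lemma mul_sq_mul_eq_sum_add {A : Type*} [CommRing A] {r V : A} (h : (1 - r) * V = 1) (M : ℕ)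
    (T G : A) :
    T * (r * V ^ 2) * G = ∑ ν ∈ Finset.range M, (ν : A) * (T * r ^ ν * G) +
      T * r ^ M * (((M : A) * V + r * V ^ 2) * G) := by
  have h2 : ∑ ν ∈ Finset.range M, (ν : A) * (T * r ^ ν * G) =
      T * (∑ ν ∈ Finset.range M, (ν : A) * r ^ ν) * G := by
    rw [Finset.mul_sum, Finset.sum_mul]
    exact Finset.sum_congr rfl fun ν _ => by ring
  rw [h2]
  linear_combination T * G * mul_sq_eq_sum_add h M

/-- The remainder is divisible by the monomial of `shift i j M`, whose tail at `j` is `1 + M`, too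
large to contribute at `m`. -/
lemma coeffAt_ratio_sq {i j : Fin N} (h : i < j) {m : Fin N → ℤ} {M : ℕ} (hM : tail m j < M)
    (G : Ser N) :
    coeffAt m (tvar i * tvar j * (ratio i j * geomInv (ratio i j) ^ 2) * G) =
      ∑ ν ∈ Finset.range M, (ν : ℝ) • coeffAt (m - shift i j ν) G := by
  have h1 := mul_sq_mul_eq_sum_add (one_sub_mul_geomInv (constantCoeff_ratio h)) M
    (tvar i * tvar j) G
  have h2 : ∀ ν : ℕ, (ν : Ser N) * (tvar i * tvar j * ratio i j ^ ν * G) =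
      (ν : ℝ) • (mono (shift i j ν) * G) := fun ν => by
    rw [← tvar_mul_mono_pow h ν, Algebra.smul_def, map_natCast]
  simp only [h2] at h1
  rw [tvar_mul_mono_pow h M] at h1
  rw [h1, map_add, map_sum, coeffAt_mono_mul _ (tail_shift_nonneg h.le M), coeffAt_of_neg, add_zero]
  · refine Finset.sum_congr rfl fun ν _ => ?_
    rw [map_smul, coeffAt_mono_mul _ (tail_shift_nonneg h.le ν)]
  · refine ⟨j, ?_⟩
    rw [tail_sub, tail_shift_of_lt h]
    omega

lemma tvar_sq (k : Fin N) : tvar k ^ 2 = mono (shift k k 0) := by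
  rw [sq, tvar, mono_mul (tail_single_nonneg k) (tail_single_nonneg k), shift_self, two_smul]

lemma fPoly_pde (lam : ℝ) (m : Fin N → ℤ) {M : ℕ} (hM : ∀ k, tail m k < M) :
    ∑ i, MvPolynomial.pderiv i (MvPolynomial.pderiv i (fPoly lam m)) +
        (2 * lam) • ∑ i : Fin N, ∑ j ∈ Finset.Ioi i, fQuot lam m i j =
      ∑ k, ((((m k : ℝ) - 2) + lam * (N - k)) * (((m k : ℝ) - 2) + lam * (N - k) + 1)) •
        fPoly lam (m - shift k k 0) -
      (2 * lam * (lam - 1)) • ∑ i : Fin N, ∑ j ∈ Finset.Ioi i, ∑ ν ∈ Finset.range M,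
        (ν : ℝ) • fPoly lam (m - shift i j ν) := by
  have h := congrArg (coeffAt m) (genSeries_pde (N := N) lam)
  simp only [map_add, map_sub, map_sum, map_smul, coeffAt_dx] at h
  refine h.trans ?_
  congr 1
  · refine Finset.sum_congr rfl fun k _ => ?_
    rw [tvar_sq, coeffAt_mono_mul _ (tail_shift_nonneg le_rfl 0)]
    simp only [map_add, map_smul, coeffAt_theta, ← fPoly.eq_1]
    -- The factor `t_k²` stands to the left of the Euler operators, so they act on the index already
    -- lowered by 2.
    have : ((m - shift k k 0) k : ℝ) = (m k : ℝ) - 2 := by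
      rw [shift_self]; simp
    rw [this]
    module
  · congr 1
    refine Finset.sum_congr rfl fun i _ => Finset.sum_congr rfl fun j hj => ?_
    exact coeffAt_ratio_sq (Finset.mem_Ioi.mp hj) (hM j) _

/-- Steps as triples. -/
def stepEquiv : Step N ≃ {p : Fin N × Fin N × ℕ // p.1 ≤ p.2.1} where
  toFun c := ⟨(c.j, c.k, c.ν), c.le⟩
  invFun p := ⟨p.1.1, p.1.2.1, p.2, p.1.2.2⟩
  left_inv _ := rfl
  right_inv _ := rfl

/-- The steps with `ν < M`. -/
def stepsBelow (N M : ℕ) : Finset (Step N) :=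
  ((Finset.univ ×ˢ Finset.univ ×ˢ Finset.range M).subtype
    fun p : Fin N × Fin N × ℕ => p.1 ≤ p.2.1).map stepEquiv.symm.toEmbedding

lemma mem_stepsBelow {M : ℕ} {c : Step N} : c ∈ stepsBelow N M ↔ c.ν < M := by
  simp [stepsBelow, Finset.mem_map_equiv, stepEquiv]

lemma sum_stepsBelow {E : Type*} [AddCommMonoid E] (M : ℕ) (u : Fin N → Fin N → ℕ → E) :
    ∑ c ∈ stepsBelow N M, u c.j c.k c.ν =
      ∑ j, ∑ k ∈ Finset.Ici j, ∑ ν ∈ Finset.range M, u j k ν := by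
  rw [stepsBelow, Finset.sum_map]
  refine (Finset.sum_subtype_eq_sum_filter (p := fun p : Fin N × Fin N × ℕ => p.1 ≤ p.2.1)
    (fun p => u p.1 p.2.1 p.2.2)).trans ?_
  rw [Finset.sum_filter, Finset.sum_product]
  refine Finset.sum_congr rfl fun j _ => ?_
  rw [Finset.sum_product]
  have : Finset.Ici j = Finset.univ.filter (fun k => j ≤ k) := by ext; simp
  rw [this, Finset.sum_filter]
  refine Finset.sum_congr rfl fun k _ => ?_
  split_ifs <;> simp

lemma shifted_sub_shift (lam : ℝ) (m : Fin N → ℤ) (k : Fin N) :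
    shifted lam (m - shift k k 0) k = (m k : ℝ) - 2 + lam * (N - k) := by
  rw [shifted, shift_self]
  simp

/-- The reduced Hamiltonian, on a polynomial `p` with given quotients of `(∂_i - ∂_j) p` by
`x_i - x_j`, maps `f_m` to a combination of `f_m` and of lower `f`'s. -/
lemma fPoly_reduced (lam : ℝ) (m : Fin N → ℤ) {M : ℕ} (hM0 : 0 < M) (hM : ∀ k, tail m k < M) :
    -∑ i, MvPolynomial.pderiv i (MvPolynomial.pderiv i (fPoly lam m)) -
        (2 * lam) • ∑ i : Fin N, ∑ j ∈ Finset.Ioi i, fQuot lam m i j =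
      ∑ c ∈ stepsBelow N M, g lam c.j c.k c.ν (m - c.vec) • fPoly lam (m - c.vec) := by
  have h := fPoly_pde lam m hM
  have h1 := sum_stepsBelow M fun j k ν : _ => g lam j k ν (m - shift j k ν) •
    fPoly lam (m - shift j k ν)
  have h2 : ∀ j : Fin N, ∑ k ∈ Finset.Ici j, ∑ ν ∈ Finset.range M,
      g lam j k ν (m - shift j k ν) • fPoly lam (m - shift j k ν) =
      -((((m j : ℝ) - 2) + lam * (N - j)) * (((m j : ℝ) - 2) + lam * (N - j) + 1)) •
        fPoly lam (m - shift j j 0) + (2 * lam * (lam - 1)) • ∑ k ∈ Finset.Ioi j,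
          ∑ ν ∈ Finset.range M, (ν : ℝ) • fPoly lam (m - shift j k ν) := by
    intro j
    have e : Finset.Ici j = insert j (Finset.Ioi j) := by simp
    rw [e, Finset.sum_insert (by simp)]
    congr 1
    -- For equal indices `g` vanishes unless `ν = 0`; the positivity of `M` keeps that term in the
    -- range.
    · rw [Finset.sum_eq_single 0]
      · rw [← shifted_sub_shift, g]
        simp
      · intro ν _ hν
        simp [g, hν]
      · intro h0
        simp at h0
        omega
    · rw [Finset.smul_sum]
      refine Finset.sum_congr rfl fun k hk => ?_
      rw [Finset.smul_sum]
      refine Finset.sum_congr rfl fun ν _ => ?_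
      rw [smul_smul, g, if_neg (Finset.mem_Ioi.mp hk).ne]
      simp
  refine Eq.trans ?_ h1.symm
  simp only [h2, Finset.sum_add_distrib, neg_smul, Finset.sum_neg_distrib, ← Finset.smul_sum]
  rw [← neg_add', h]
  abel

end

noncomputable section

/-! ### The coefficients `α_n(m)` -/

variable {N : ℕ}

lemma Step.tail_vec_nonneg (c : Step N) (k : Fin N) : 0 ≤ tail c.vec k := tail_shift_nonneg c.le _ k

lemma Step.sum_vec (c : Step N) : ∑ i, c.vec i = 2 := by
  simp only [Step.vec, shift, Pi.add_apply, Pi.smul_apply, smul_eq_mul, Finset.sum_add_distrib,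
    ← Finset.mul_sum, Finset.sum_pi_single', Finset.mem_univ, if_true]
  ring

lemma tail_sum {ι : Type*} (s : Finset ι) (v : ι → Fin N → ℤ) (k : Fin N) :
    tail (∑ r ∈ s, v r) k = ∑ r ∈ s, tail (v r) k := by
  simp only [tail, Finset.sum_apply]
  exact Finset.sum_comm

/-- For `j < k` the tail of the step at `k` is `1 + ν`, and for `j = k` the coefficient `g` kills
every `ν > 0`. Bounded tails therefore leave finitely many relevant steps. -/
lemma nu_lt_of_g_ne_zero {lam : ℝ} {m : Fin N → ℤ} (c : Step N) (hg : g lam c.j c.k c.ν m ≠ 0)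
    {M : ℕ} (hM0 : 0 < M) (hM : tail c.vec c.k < M) : c.ν < M := by
  rcases eq_or_lt_of_le c.le with h | h
  · rcases Nat.eq_zero_or_pos c.ν with h0 | h0
    · omega
    · exact absurd (by simp [g, h, h0.ne']) hg
  · rw [Step.vec, tail_shift_of_lt h] at hM
    omega

section Chains

variable {lam : ℝ} {n m : Fin N → ℤ}

lemma eq_of_chainTerm_ne_zero {s : ℕ} {c : Fin s → Step N} (h : chainTerm lam n m c ≠ 0) :
    m + ∑ r, (c r).vec = n := by
  by_contra hne
  exact h (by rw [chainTerm, if_neg hne, zero_mul])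

/-- Each step has total 2, so the end points determine the length of the chain. -/
lemma sum_eq_of_chainTerm_ne_zero {s : ℕ} {c : Fin s → Step N} (h : chainTerm lam n m c ≠ 0) :
    ∑ i, n i - ∑ i, m i = 2 * s := by
  rw [← eq_of_chainTerm_ne_zero h]
  simp only [Pi.add_apply, Finset.sum_apply, Finset.sum_add_distrib]
  rw [Finset.sum_comm]
  simp [Step.sum_vec, mul_comm]

lemma tail_vec_le_of_chainTerm_ne_zero {s : ℕ} {c : Fin s → Step N}
    (h : chainTerm lam n m c ≠ 0) (r : Fin s) (k : Fin N) :
    tail (c r).vec k ≤ tail (n - m) k := by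
  have h1 : n - m = ∑ r, (c r).vec := by rw [← eq_of_chainTerm_ne_zero h]; abel
  rw [h1, tail_sum]
  exact Finset.single_le_sum (f := fun r => tail (c r).vec k)
    (fun i _ => (c i).tail_vec_nonneg k) (Finset.mem_univ r)

lemma tail_le_of_chainTerm_ne_zero {s : ℕ} {c : Fin s → Step N}
    (h : chainTerm lam n m c ≠ 0) (k : Fin N) : tail m k ≤ tail n k := by
  rw [← eq_of_chainTerm_ne_zero h, tail_add, tail_sum]
  have := Finset.sum_nonneg (s := Finset.univ) fun r _ => (c r).tail_vec_nonneg k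
  omega

lemma mem_piFinset_of_chainTerm_ne_zero {s : ℕ} {c : Fin s → Step N}
    (h : chainTerm lam n m c ≠ 0) {M : ℕ} (hM0 : 0 < M) (hM : ∀ k, tail (n - m) k < M) :
    c ∈ Fintype.piFinset fun _ => stepsBelow N M := by
  refine Fintype.mem_piFinset.mpr fun r => mem_stepsBelow.mpr ?_
  refine nu_lt_of_g_ne_zero (c r) (lam := lam) (m := n - ∑ l ∈ Finset.Iic r, (c l).vec) ?_ hM0
    ((tail_vec_le_of_chainTerm_ne_zero h r _).trans_lt (hM _))
  intro h0
  exact h (by rw [chainTerm, Finset.prod_eq_zero (Finset.mem_univ r) h0, mul_zero])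

lemma exists_bound (v : Fin N → ℤ) : ∃ M : ℕ, 0 < M ∧ ∀ k, v k < M := by
  refine ⟨∑ k, (v k).toNat + 1, by omega, fun k => ?_⟩
  have := Finset.single_le_sum (f := fun k => (v k).toNat) (fun _ _ => Nat.zero_le _)
    (Finset.mem_univ k)
  have h2 := Int.self_le_toNat (v k)
  omega

variable (lam n m) in
lemma finite_chainTerm_ne_zero :
    {c : Σ s : ℕ, Fin s → Step N | chainTerm lam n m c.2 ≠ 0}.Finite := by
  obtain ⟨M, hM0, hM⟩ := exists_bound (tail (n - m))
  refine Set.Finite.subset ((Finset.range ((∑ i, n i - ∑ i, m i).toNat + 1)).sigma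
    fun s => Fintype.piFinset fun _ : Fin s => stepsBelow N M).finite_toSet ?_
  intro c hc
  have h := sum_eq_of_chainTerm_ne_zero hc
  rw [Finset.mem_coe, Finset.mem_sigma, Finset.mem_range]
  exact ⟨by omega, mem_piFinset_of_chainTerm_ne_zero hc hM0 hM⟩

variable (lam n m) in
/-- The sum over all chains of `s` steps. -/
def chainSum (s : ℕ) : ℝ := ∑ᶠ c : Fin s → Step N, chainTerm lam n m c

lemma chainSum_eq_sum (s : ℕ) {M : ℕ} (hM0 : 0 < M) (hM : ∀ k, tail (n - m) k < M) :
    chainSum lam n m s =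
      ∑ c ∈ Fintype.piFinset fun _ : Fin s => stepsBelow N M, chainTerm lam n m c :=
  finsum_eq_finsetSum_of_support_subset _ fun _ hc => mem_piFinset_of_chainTerm_ne_zero hc hM0 hM

lemma exists_of_chainSum_ne_zero {s : ℕ} (h : chainSum lam n m s ≠ 0) :
    ∃ c : Fin s → Step N, chainTerm lam n m c ≠ 0 := by
  by_contra! h0
  exact h (by simp [chainSum, h0])

lemma sum_Iic_castSucc {A : Type*} [AddCommMonoid A] {s : ℕ} (v : Fin (s + 1) → A) (r : Fin s) :
    ∑ l ∈ Finset.Iic r.castSucc, v l = ∑ l ∈ Finset.Iic r, v l.castSucc := by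
  rw [← Fin.map_castSuccEmb_Iic, Finset.sum_map]
  rfl

/-- Peeling off the last step, the one nearest to `m`: the partial sum in its factor is the full
one, so `g` is evaluated at `m` itself, and the other steps form a chain for `m + (c (Fin.last
s)).vec`. -/
lemma chainTerm_succ {s : ℕ} (c : Fin (s + 1) → Step N) :
    chainTerm lam n m c = g lam (c (Fin.last s)).j (c (Fin.last s)).k (c (Fin.last s)).ν m *
      chainTerm lam n (m + (c (Fin.last s)).vec) fun r => c r.castSucc := by
  unfold chainTerm
  rw [Fin.sum_univ_castSucc, Fin.prod_univ_castSucc]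
  have e : m + (c (Fin.last s)).vec + ∑ r : Fin s, (c r.castSucc).vec =
      m + (∑ r : Fin s, (c r.castSucc).vec + (c (Fin.last s)).vec) := by abel
  rw [e]
  simp only [sum_Iic_castSucc fun l => (c l).vec]
  split_ifs with h
  · have h1 : n - ∑ l ∈ Finset.Iic (Fin.last s), (c l).vec = m := by
      have : Finset.Iic (Fin.last s) = Finset.univ := by ext; simp [Fin.le_last]
      rw [this, Fin.sum_univ_castSucc, ← h]
      abel
    rw [h1]
    ring
  · ring

lemma chainSum_succ (s : ℕ) {M : ℕ} (hM0 : 0 < M) (hM : ∀ k, tail (n - m) k < M) :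
    chainSum lam n m (s + 1) =
      ∑ c ∈ stepsBelow N M, g lam c.j c.k c.ν m * chainSum lam n (m + c.vec) s := by
  have h1 : ∀ c : Step N, ∀ k, tail (n - (m + c.vec)) k < M := fun c k => by
    have e : n - (m + c.vec) = n - m - c.vec := by abel
    rw [e, tail_sub]
    have := c.tail_vec_nonneg k
    have := hM k
    omega
  rw [chainSum_eq_sum _ hM0 hM]
  simp only [fun c : Step N => chainSum_eq_sum (lam := lam) s hM0 (h1 c), Finset.mul_sum]
  rw [← Finset.sum_product' (f := fun (c : Step N) (c' : Fin s → Step N) =>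
    g lam c.j c.k c.ν m * chainTerm lam n (m + c.vec) c')]
  refine Finset.sum_bij' (fun c _ => (c (Fin.last s), fun r => c r.castSucc))
    (fun p _ => Fin.snoc (α := fun _ => Step N) p.2 p.1) ?_ ?_ ?_ ?_ ?_
  · intro c hc
    rw [Fintype.mem_piFinset] at hc
    exact Finset.mem_product.mpr ⟨hc _, Fintype.mem_piFinset.mpr fun r => hc _⟩
  · intro p hp
    have hp := Finset.mem_product.mp hp
    refine Fintype.mem_piFinset.mpr fun r => ?_
    refine Fin.lastCases ?_ (fun r => ?_) r
    · rw [Fin.snoc_last]; exact hp.1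
    · rw [Fin.snoc_castSucc]; exact Fintype.mem_piFinset.mp hp.2 r
  · intro c _
    exact Fin.snoc_init_self c
  · intro p _
    simp
  · intro c _
    exact chainTerm_succ c

/-- The length being forced, a single `s` survives in the series. For `s = 0` the empty chain
reproduces the Kronecker delta. -/
lemma alpha_eq_chainSum {s : ℕ} (h : ∑ i, n i - ∑ i, m i = 2 * s) :
    alpha lam n m = 1 / ((4 : ℝ) ^ s * (s ! : ℝ)) * chainSum lam n m s := by
  have h1 : ∀ s' : ℕ, s' ≠ s → chainSum lam n m s' = 0 := fun s' hs => by
    by_contra h0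
    obtain ⟨c, hc⟩ := exists_of_chainSum_ne_zero h0
    have := sum_eq_of_chainTerm_ne_zero hc
    omega
  have h2 : ∀ s' : ℕ, s' ≠ s → (∑ᶠ (_ : 1 ≤ s'), 1 / ((4 : ℝ) ^ s' * (s' ! : ℝ)) *
      ∑ᶠ c : Fin s' → Step N, chainTerm lam n m c) = 0 := fun s' hs => by
    have := h1 s' hs
    rw [chainSum] at this
    simp [this]
  rw [alpha, finsum_eq_single _ s h2]
  rcases Nat.eq_zero_or_pos s with h0 | h0
  · subst h0
    have e : chainSum lam n m 0 = chainTerm lam n m default := finsum_unique _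
    rw [e, finsum_eq_if]
    simp [chainTerm]
  · rw [if_neg, zero_add, finsum_eq_if, if_pos (show 1 ≤ s from h0), chainSum]
    rintro rfl
    simp at h
    omega

lemma exists_of_alpha_ne_zero (h : alpha lam n m ≠ 0) :
    ∃ s : ℕ, ∑ i, n i - ∑ i, m i = 2 * s ∧ ∀ k, tail m k ≤ tail n k := by
  by_cases hs : ∃ s : ℕ, ∑ i, n i - ∑ i, m i = 2 * s
  · obtain ⟨s, hs⟩ := hs
    refine ⟨s, hs, ?_⟩
    rw [alpha_eq_chainSum hs] at h
    obtain ⟨c, hc⟩ := exists_of_chainSum_ne_zero (right_ne_zero_of_mul h)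
    exact tail_le_of_chainTerm_ne_zero hc
  · exfalso
    apply h
    have h1 : ∀ s' : ℕ, ∀ c : Fin s' → Step N, chainTerm lam n m c = 0 := fun s' c => by
      by_contra h0
      exact hs ⟨s', sum_eq_of_chainTerm_ne_zero h0⟩
    rw [alpha, if_neg]
    · simp [h1]
    · rintro rfl
      exact hs ⟨0, by simp⟩

/-- When `|n| - |m| = 2(s + 1)`, the factor on the left is `4(s + 1)`, the quotient of the
normalisations for `s + 1` and `s` steps, and what remains is `chainSum_succ`. Otherwise both sides
are zero. -/
lemma alpha_recurrence {M : ℕ} (hM0 : 0 < M) (hM : ∀ k, tail (n - m) k < M) :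
    2 * (∑ i, (n i : ℝ) - ∑ i, (m i : ℝ)) * alpha lam n m =
      ∑ c ∈ stepsBelow N M, g lam c.j c.k c.ν m * alpha lam n (m + c.vec) := by
  have hsum : ∀ c : Step N, ∑ i, (m + c.vec) i = ∑ i, m i + 2 := fun c => by
    rw [← c.sum_vec, ← Finset.sum_add_distrib]; rfl
  by_cases hs : ∃ s : ℕ, ∑ i, n i - ∑ i, m i = 2 * (s + 1 : ℕ)
  · obtain ⟨s, hs⟩ := hs
    have h1 : ∀ c : Step N, alpha lam n (m + c.vec) =
        1 / ((4 : ℝ) ^ s * (s ! : ℝ)) * chainSum lam n (m + c.vec) s := fun c =>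
      alpha_eq_chainSum (by rw [hsum]; push_cast at hs; omega)
    have h2 : ∑ i, (n i : ℝ) - ∑ i, (m i : ℝ) = 2 * ((s : ℝ) + 1) := by exact_mod_cast hs
    rw [alpha_eq_chainSum hs, chainSum_succ s hM0 hM, h2]
    simp only [h1]
    rw [Finset.mul_sum, Finset.mul_sum]
    refine Finset.sum_congr rfl fun c _ => ?_
    have h3 : (s ! : ℝ) ≠ 0 := by positivity
    have h4 : (s : ℝ) + 1 ≠ 0 := by positivity
    rw [Nat.factorial_succ]
    push_cast
    field_simp
    ring
  · symm
    rw [Finset.sum_eq_zero]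
    · symm
      by_cases h0 : alpha lam n m = 0
      · rw [h0, mul_zero]
      · obtain ⟨s, h1, -⟩ := exists_of_alpha_ne_zero h0
        rcases s with _ | s
        · have : ∑ i, (n i : ℝ) - ∑ i, (m i : ℝ) = 0 := by exact_mod_cast h1
          rw [this]; simp
        · exact absurd ⟨s, h1⟩ hs
    · intro c _
      by_cases h0 : alpha lam n (m + c.vec) = 0
      · rw [h0, mul_zero]
      · obtain ⟨s, h1, -⟩ := exists_of_alpha_ne_zero h0
        refine absurd ⟨s, ?_⟩ hs
        rw [hsum] at h1
        push_cast
        omega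

end Chains

/-! ### The reduced eigenfunctions -/

/-- The exponents `m` with `0 ≤ m_k + ⋯ + m_N ≤ n_k + ⋯ + n_N` for all `k`. -/
def tailBox (n : Fin N → ℤ) : Set (Fin N → ℤ) := {m | ∀ k, 0 ≤ tail m k ∧ tail m k ≤ tail n k}

lemma tail_injective : Function.Injective (tail : (Fin N → ℤ) → Fin N → ℤ) := by
  intro m m' h
  funext k
  have h1 := tail_eq_add m k
  have h2 := tail_eq_add m' k
  rw [h] at h1
  omega

lemma tailBox_finite (n : Fin N → ℤ) : (tailBox n).Finite := by
  refine Set.Finite.of_finite_image (f := tail) ?_ tail_injective.injOn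
  refine (Set.finite_Icc (0 : Fin N → ℤ) (tail n)).subset ?_
  rintro _ ⟨m, hm, rfl⟩
  exact ⟨fun k => (hm k).1, fun k => (hm k).2⟩

lemma mem_tailBox {lam : ℝ} {n m : Fin N → ℤ} (h1 : alpha lam n m ≠ 0) (h2 : fPoly lam m ≠ 0) :
    m ∈ tailBox n := by
  obtain ⟨s, -, h⟩ := exists_of_alpha_ne_zero h1
  refine fun k => ⟨?_, h k⟩
  by_contra! h0
  exact h2 (fPoly_of_neg lam ⟨k, h0⟩)

/-- The polynomial `P_n`. -/
def pPoly (lam : ℝ) (n : Fin N → ℤ) : MvPolynomial (Fin N) ℝ :=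
  ∑ m ∈ (tailBox_finite n).toFinset, alpha lam n m • fPoly lam m

/-- The quotient of `(∂_i - ∂_j) P_n` by `x_i - x_j`. -/
def pQuot (lam : ℝ) (n : Fin N → ℤ) (i j : Fin N) : MvPolynomial (Fin N) ℝ :=
  ∑ m ∈ (tailBox_finite n).toFinset, alpha lam n m • fQuot lam m i j

lemma sub_mul_pQuot (lam : ℝ) (n : Fin N → ℤ) (i j : Fin N) :
    (MvPolynomial.X i - MvPolynomial.X j) * pQuot lam n i j =
      MvPolynomial.pderiv i (pPoly lam n) - MvPolynomial.pderiv j (pPoly lam n) := by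
  simp only [pQuot, pPoly, map_sum, Finset.mul_sum, mul_smul_comm, sub_mul_fQuot, smul_sub,
    Derivation.map_smul, Finset.sum_sub_distrib]

/-- Translation by `c.vec` does not preserve the box, but a nonzero summand forces both `m` and `m -
c.vec` into it. Both sums are therefore full sums over the lattice, where reindexing is free. -/
lemma sum_alpha_smul_shift (lam : ℝ) (n : Fin N → ℤ) (c : Step N) :
    ∑ m ∈ (tailBox_finite n).toFinset,
        alpha lam n m • (g lam c.j c.k c.ν (m - c.vec) • fPoly lam (m - c.vec)) =
      ∑ m ∈ (tailBox_finite n).toFinset,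
        alpha lam n (m + c.vec) • (g lam c.j c.k c.ν m • fPoly lam m) := by
  have key : ∀ m, alpha lam n m ≠ 0 → fPoly lam (m - c.vec) ≠ 0 →
      m ∈ tailBox n ∧ m - c.vec ∈ tailBox n := by
    intro m h1 h2
    obtain ⟨s, -, h⟩ := exists_of_alpha_ne_zero h1
    have h3 : ∀ k, 0 ≤ tail (m - c.vec) k := fun k => by
      by_contra! h0
      exact h2 (fPoly_of_neg lam ⟨k, h0⟩)
    have h4 := c.tail_vec_nonneg
    simp only [tail_sub] at h3
    refine ⟨fun k => ⟨?_, h k⟩, fun k => ?_⟩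
    · have := h3 k; have := h4 k; omega
    · rw [tail_sub]
      have := h3 k; have := h4 k; have := h k
      omega
  have h1 : ∑ m ∈ (tailBox_finite n).toFinset,
        alpha lam n m • (g lam c.j c.k c.ν (m - c.vec) • fPoly lam (m - c.vec)) =
      ∑ᶠ m, alpha lam n m • (g lam c.j c.k c.ν (m - c.vec) • fPoly lam (m - c.vec)) := by
    refine (finsum_eq_finsetSum_of_support_subset _ fun m hm => ?_).symm
    rw [Function.mem_support] at hm
    rw [Set.Finite.coe_toFinset]
    exact (key m (left_ne_zero_of_smul hm) (right_ne_zero_of_smul (right_ne_zero_of_smul hm))).1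
  have h2 : ∑ m ∈ (tailBox_finite n).toFinset,
        alpha lam n (m + c.vec) • (g lam c.j c.k c.ν m • fPoly lam m) =
      ∑ᶠ m, alpha lam n (m + c.vec) • (g lam c.j c.k c.ν m • fPoly lam m) := by
    refine (finsum_eq_finsetSum_of_support_subset _ fun m hm => ?_).symm
    rw [Function.mem_support] at hm
    rw [Set.Finite.coe_toFinset]
    have := (key (m + c.vec) (left_ne_zero_of_smul hm) (by
      rw [add_sub_cancel_right]
      exact right_ne_zero_of_smul (right_ne_zero_of_smul hm))).2
    rwa [add_sub_cancel_right] at this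
  rw [h1, h2, ← finsum_comp_equiv (Equiv.addRight c.vec)]
  simp

/-- `P_n` is an eigenfunction of the reduced Hamiltonian. -/
lemma pPoly_eigen (lam : ℝ) (n : Fin N → ℤ) :
    -∑ i, MvPolynomial.pderiv i (MvPolynomial.pderiv i (pPoly lam n)) +
        (2 : ℝ) • ∑ i, MvPolynomial.X i * MvPolynomial.pderiv i (pPoly lam n) -
        (2 * lam) • ∑ i : Fin N, ∑ j ∈ Finset.Ioi i, pQuot lam n i j =
      (2 * ∑ i, (n i : ℝ)) • pPoly lam n := by
  obtain ⟨M, hM0, hM⟩ := exists_bound (tail n)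
  set B := (tailBox_finite n).toFinset with hB
  have hB' : ∀ m ∈ B, m ∈ tailBox n := fun m hm => by simpa [hB] using hm
  have h1 : ∀ m ∈ B, -∑ i, MvPolynomial.pderiv i (MvPolynomial.pderiv i (fPoly lam m)) +
        (2 : ℝ) • ∑ i, MvPolynomial.X i * MvPolynomial.pderiv i (fPoly lam m) -
        (2 * lam) • ∑ i : Fin N, ∑ j ∈ Finset.Ioi i, fQuot lam m i j =
      (2 * ∑ i, (m i : ℝ)) • fPoly lam m +
        ∑ c ∈ stepsBelow N M, g lam c.j c.k c.ν (m - c.vec) • fPoly lam (m - c.vec) := by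
    intro m hm
    rw [← fPoly_reduced lam m hM0 fun k => ((hB' m hm k).2).trans_lt (hM k), euler_fPoly]
    module
  -- The contributions of higher terms to `f_m` supply exactly the `2(|n| - |m|) α(m)` missing from
  -- the diagonal part `2|m| α(m)`.
  have h2 : ∀ m ∈ B, ∑ c ∈ stepsBelow N M, alpha lam n (m + c.vec) •
      (g lam c.j c.k c.ν m • fPoly lam m) =
      (2 * (∑ i, (n i : ℝ) - ∑ i, (m i : ℝ)) * alpha lam n m) • fPoly lam m := by
    intro m hm
    rw [alpha_recurrence hM0, Finset.sum_smul]
    · exact Finset.sum_congr rfl fun c _ => by rw [smul_smul, mul_comm]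
    · intro k
      rw [tail_sub]
      have := (hB' m hm k).1
      have := hM k
      omega
  have h3 : -∑ i, MvPolynomial.pderiv i (MvPolynomial.pderiv i (pPoly lam n)) +
        (2 : ℝ) • ∑ i, MvPolynomial.X i * MvPolynomial.pderiv i (pPoly lam n) -
        (2 * lam) • ∑ i : Fin N, ∑ j ∈ Finset.Ioi i, pQuot lam n i j =
      ∑ m ∈ B, alpha lam n m •
        (-∑ i, MvPolynomial.pderiv i (MvPolynomial.pderiv i (fPoly lam m)) +
        (2 : ℝ) • ∑ i, MvPolynomial.X i * MvPolynomial.pderiv i (fPoly lam m) -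
        (2 * lam) • ∑ i : Fin N, ∑ j ∈ Finset.Ioi i, fQuot lam m i j) := by
    simp only [smul_sub, smul_add, smul_neg, Finset.sum_sub_distrib, Finset.sum_add_distrib,
      Finset.sum_neg_distrib]
    congr 1
    · congr 1
      · rw [neg_inj]
        simp only [pPoly, map_sum, Derivation.map_smul, Finset.smul_sum, ← hB]
        exact Finset.sum_comm
      · simp only [pPoly, map_sum, Derivation.map_smul, Finset.smul_sum, ← hB, Finset.mul_sum,
          mul_smul_comm]
        rw [Finset.sum_comm]
        exact Finset.sum_congr rfl fun m _ => Finset.sum_congr rfl fun i _ => smul_comm _ _ _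
    · simp only [pQuot, Finset.smul_sum, ← hB]
      rw [Finset.sum_congr rfl fun i _ => Finset.sum_comm, Finset.sum_comm]
      exact Finset.sum_congr rfl fun m _ => Finset.sum_congr rfl fun i _ =>
        Finset.sum_congr rfl fun j _ => smul_comm _ _ _
  rw [h3, Finset.sum_congr rfl fun m hm => by rw [h1 m hm]]
  simp only [smul_add, Finset.smul_sum, Finset.sum_add_distrib]
  rw [Finset.sum_comm (s := B) (t := stepsBelow N M),
    Finset.sum_congr rfl fun c _ => sum_alpha_smul_shift lam n c, ← hB, Finset.sum_comm,
    Finset.sum_congr rfl h2, ← Finset.sum_add_distrib, pPoly, Finset.smul_sum]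
  refine Finset.sum_congr rfl fun m _ => ?_
  module

end

noncomputable section

/-! ### The contour integrals as coefficients of the generating function -/

variable {N : ℕ}

/-- The value of the monomial with exponent `b` at `t_k = 1 / y_k`. -/
def monoEval (y : Fin N → ℂ) (b : Fin N →₀ ℕ) : ℂ := ∏ k, y k ^ (-intWeight k b)

lemma monoEval_add {y : Fin N → ℂ} (hy : ∀ k, y k ≠ 0) (a b : Fin N →₀ ℕ) :
    monoEval y (a + b) = monoEval y a * monoEval y b := by
  simp only [monoEval, intWeight_add, neg_add, ← Finset.prod_mul_distrib]
  exact Finset.prod_congr rfl fun k _ => zpow_add₀ (hy k) _ _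

lemma monoEval_zero (y : Fin N → ℂ) : monoEval y 0 = 1 := by simp [monoEval, intWeight_zero]

lemma monoEval_nsmul {y : Fin N → ℂ} (hy : ∀ k, y k ≠ 0) (n : ℕ) (b : Fin N →₀ ℕ) :
    monoEval y (n • b) = monoEval y b ^ n := by
  induction n with
  | zero => simp [monoEval_zero]
  | succ n ih => rw [succ_nsmul, monoEval_add hy, ih, pow_succ]

lemma monoEval_single (y : Fin N → ℂ) (k : Fin N) :
    monoEval y (tailExp (Pi.single k 1)) = (y k)⁻¹ := by
  rw [monoEval, Finset.prod_eq_single k]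
  · rw [intWeight_tailExp _ (tail_single_nonneg k)]; simp
  · intro j _ hj
    rw [intWeight_tailExp _ (tail_single_nonneg k)]; simp [hj]
  · simp

lemma monoEval_single_sub {y : Fin N → ℂ} (hy : ∀ k, y k ≠ 0) {j k : Fin N} (h : j < k) :
    monoEval y (tailExp (Pi.single k 1 - Pi.single j 1)) = y j / y k := by
  have h1 := monoEval_add hy (tailExp (Pi.single j 1)) (tailExp (Pi.single k 1 - Pi.single j 1))
  rw [← tailExp_add (tail_single_nonneg j) (tail_single_sub_nonneg h.le), add_sub_cancel,
    monoEval_single, monoEval_single] at h1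
  have := hy j
  have := hy k
  field_simp at h1 ⊢
  rw [← h1]

/-- The power series `p` converges absolutely to `v` at `t_k = 1 / y_k`. -/
structure HasExpansion (p : MvPowerSeries (Fin N) ℂ) (y : Fin N → ℂ) (v : ℂ) : Prop where
  summable : Summable fun b => ‖MvPowerSeries.coeff b p * monoEval y b‖
  tsum_eq : ∑' b, MvPowerSeries.coeff b p * monoEval y b = v

lemma HasExpansion.one (y : Fin N → ℂ) : HasExpansion 1 y 1 := by
  classical
  have h : ∀ b : Fin N →₀ ℕ, b ≠ 0 →
      MvPowerSeries.coeff b (1 : MvPowerSeries (Fin N) ℂ) * monoEval y b = 0 := fun b hb => by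
    rw [MvPowerSeries.coeff_one, if_neg hb, zero_mul]
  constructor
  · refine summable_of_ne_finset_zero (s := {0}) fun b hb => ?_
    rw [h b (by simpa using hb), norm_zero]
  · rw [tsum_eq_single 0 h, MvPowerSeries.coeff_zero_one, monoEval_zero, one_mul]

lemma HasExpansion.mul {p q : MvPowerSeries (Fin N) ℂ} {y : Fin N → ℂ} (hy : ∀ k, y k ≠ 0)
    {v w : ℂ} (hp : HasExpansion p y v) (hq : HasExpansion q y w) :
    HasExpansion (p * q) y (v * w) := by
  classical
  let u : (Fin N →₀ ℕ) → ℂ := fun b => MvPowerSeries.coeff b p * monoEval y b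
  let u' : (Fin N →₀ ℕ) → ℂ := fun b => MvPowerSeries.coeff b q * monoEval y b
  have hu : Summable fun b => ‖u b‖ := hp.summable
  have hu' : Summable fun b => ‖u' b‖ := hq.summable
  have e : (fun b => MvPowerSeries.coeff b (p * q) * monoEval y b) = fun b =>
      ∑ c ∈ Finset.HasAntidiagonal.antidiagonal b, u c.1 * u' c.2 := by
    funext b
    rw [MvPowerSeries.coeff_mul, Finset.sum_mul]
    refine Finset.sum_congr rfl fun c hc => ?_
    rw [← Finset.HasAntidiagonal.mem_antidiagonal.mp hc, monoEval_add hy]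
    ring
  have h := summable_mul_of_summable_norm hu hu'
  have h2 := hu.of_norm.tsum_mul_tsum_eq_tsum_sum_antidiagonal hu'.of_norm h
  have h3 := summable_sum_mul_antidiagonal_of_summable_mul h
  rw [← e] at h2 h3
  refine ⟨h3.norm, h2.symm.trans ?_⟩
  rw [← hp.tsum_eq, ← hq.tsum_eq]

lemma HasExpansion.prod {ι : Type*} {s : Finset ι} {p : ι → MvPowerSeries (Fin N) ℂ}
    {y : Fin N → ℂ} (hy : ∀ k, y k ≠ 0) {v : ι → ℂ} (h : ∀ i ∈ s, HasExpansion (p i) y (v i)) :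
    HasExpansion (∏ i ∈ s, p i) y (∏ i ∈ s, v i) := by
  classical
  induction s using Finset.induction_on with
  | empty => exact HasExpansion.one y
  | insert i s hi ih =>
    rw [Finset.prod_insert hi, Finset.prod_insert hi]
    exact (h i (Finset.mem_insert_self _ _)).mul hy
      (ih fun j hj => h j (Finset.mem_insert_of_mem hj))

/-- Newton's series converges to the principal power on the unit disc; this is the link between
formal series and the integrand. -/
lemma hasSum_binCoeff (μ : ℝ) {w : ℂ} (hw : ‖w‖ < 1) :
    HasSum (fun n => (binCoeff μ n : ℂ) * w ^ n) ((1 - w) ^ (μ : ℂ)) := by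
  have h := (Complex.one_add_cpow_hasFPowerSeriesOnBall_zero (a := (μ : ℂ))).hasSum
    (y := -w) (by simpa [enorm_eq_nnnorm, ← NNReal.coe_lt_coe] using hw)
  rw [zero_add, ← sub_eq_add_neg] at h
  refine h.congr_fun fun n => ?_
  have e : Ring.choose (μ : ℂ) n = ((Ring.choose μ n : ℝ) : ℂ) :=
    (Ring.map_choose Complex.ofRealHom μ n).symm
  rw [binomialSeries_apply, List.prod_ofFn, Finset.prod_const, Finset.card_univ, Fintype.card_fin,
    e, binCoeff, neg_pow, smul_eq_mul]
  push_cast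
  ring

lemma coeff_monomial_pow [DecidableEq (Fin N →₀ ℕ)] (b d : Fin N →₀ ℕ) (r : ℂ) (n : ℕ) :
    MvPowerSeries.coeff d (MvPowerSeries.monomial b r ^ n) = if d = n • b then r ^ n else 0 := by
  rw [MvPowerSeries.monomial_pow]
  split_ifs with h
  · rw [h, MvPowerSeries.coeff_monomial_same]
  · exact MvPowerSeries.coeff_monomial_ne h _

lemma nsmul_injective_of_ne_zero {b : Fin N →₀ ℕ} (hb : b ≠ 0) :
    Function.Injective fun n : ℕ => n • b := fun n n' h => by
  obtain ⟨i, hi⟩ := Finsupp.ne_iff.mp hb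
  have := DFunLike.congr_fun h i
  simpa [show b i ≠ 0 from hi] using this

lemma coeff_binSeries_monomial (μ : ℝ) {b : Fin N →₀ ℕ} (hb : b ≠ 0) (r : ℂ) (n : ℕ) :
    MvPowerSeries.coeff (n • b) (binSeries μ (MvPowerSeries.monomial b r)) =
      (binCoeff μ n : ℂ) * r ^ n := by
  classical
  change MvPowerSeries.coeff (n • b) (∑ i ∈ Finset.range ((n • b).degree + 1),
    binCoeff μ i • MvPowerSeries.monomial b r ^ i) = _
  have h : ∀ i : ℕ, MvPowerSeries.coeff (n • b) (binCoeff μ i • MvPowerSeries.monomial b r ^ i) =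
      if n = i then (binCoeff μ i : ℂ) * r ^ i else 0 := fun i => by
    change binCoeff μ i • MvPowerSeries.coeff (n • b) (MvPowerSeries.monomial b r ^ i) = _
    rw [coeff_monomial_pow, Complex.real_smul]
    by_cases hni : n = i
    · subst hni; simp
    · rw [if_neg hni, if_neg fun e => hni (nsmul_injective_of_ne_zero hb e), mul_zero]
  rw [map_sum, Finset.sum_congr rfl fun i _ => h i, Finset.sum_ite_eq, if_pos]
  have : b.degree ≠ 0 := (Finsupp.degree_eq_zero_iff b).not.mpr hb
  rw [Finset.mem_range, map_nsmul, smul_eq_mul]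
  have := Nat.le_mul_of_pos_right n (Nat.pos_of_ne_zero this)
  omega

lemma coeff_binSeries_monomial_of_notMem (μ : ℝ) {b : Fin N →₀ ℕ} (r : ℂ) {d : Fin N →₀ ℕ}
    (hd : d ∉ Set.range fun n : ℕ => n • b) :
    MvPowerSeries.coeff d (binSeries μ (MvPowerSeries.monomial b r)) = 0 := by
  classical
  change MvPowerSeries.coeff d (∑ i ∈ Finset.range (d.degree + 1),
    binCoeff μ i • MvPowerSeries.monomial b r ^ i) = _
  rw [map_sum]
  refine Finset.sum_eq_zero fun i _ => ?_
  change binCoeff μ i • MvPowerSeries.coeff d (MvPowerSeries.monomial b r ^ i) = _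
  rw [coeff_monomial_pow, if_neg fun e => hd ⟨i, e.symm⟩, smul_zero]

/-- The series of a single monomial is supported on the multiples of its exponent, so the
multivariate sum reduces to the one-variable binomial series. -/
lemma HasExpansion.binSeries {y : Fin N → ℂ} (hy : ∀ k, y k ≠ 0) (μ : ℝ) {b : Fin N →₀ ℕ}
    (hb : b ≠ 0) {r : ℂ} (hr : ‖r * monoEval y b‖ < 1) :
    HasExpansion (binSeries μ (MvPowerSeries.monomial b r)) y
      ((1 - r * monoEval y b) ^ (μ : ℂ)) := by
  have h1 : HasSum (fun d => MvPowerSeries.coeff d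
      (Calogero.binSeries μ (MvPowerSeries.monomial b r)) * monoEval y d)
      ((1 - r * monoEval y b) ^ (μ : ℂ)) := by
    rw [← (nsmul_injective_of_ne_zero hb).hasSum_iff]
    · refine (hasSum_binCoeff μ hr).congr_fun fun n => ?_
      rw [Function.comp_apply, coeff_binSeries_monomial μ hb, monoEval_nsmul hy, mul_pow, mul_assoc]
    · intro d hd
      rw [coeff_binSeries_monomial_of_notMem μ r hd, zero_mul]
  exact ⟨h1.summable.norm, h1.tsum_eq⟩

/-- Evaluation of the coefficients at `x`, as complex numbers. -/
def evalC (x : Fin N → ℝ) : MvPolynomial (Fin N) ℝ →+* ℂ :=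
  Complex.ofRealHom.comp (MvPolynomial.eval x)

lemma evalC_smul (x : Fin N → ℝ) (r : ℝ) (p : MvPolynomial (Fin N) ℝ) :
    evalC x (r • p) = r • evalC x p := by
  simp [evalC, MvPolynomial.smul_eval]

lemma map_binSeries (x : Fin N → ℝ) (μ : ℝ) (w : Ser N) :
    MvPowerSeries.map (evalC x) (binSeries μ w) = binSeries μ (MvPowerSeries.map (evalC x) w) := by
  ext b
  rw [MvPowerSeries.coeff_map]
  change evalC x (MvPowerSeries.coeff b (∑ n ∈ Finset.range (b.degree + 1), binCoeff μ n • w ^ n)) =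
    MvPowerSeries.coeff b (∑ n ∈ Finset.range (b.degree + 1),
      binCoeff μ n • (MvPowerSeries.map (evalC x) w) ^ n)
  rw [map_sum, map_sum, map_sum]
  refine Finset.sum_congr rfl fun n _ => ?_
  rw [← map_pow]
  change evalC x (binCoeff μ n • MvPowerSeries.coeff b (w ^ n)) =
    binCoeff μ n • MvPowerSeries.coeff b (MvPowerSeries.map (evalC x) (w ^ n))
  rw [evalC_smul, MvPowerSeries.coeff_map]

lemma tailExp_ne_zero {c : Fin N → ℤ} {k : Fin N} (h : 0 < tail c k) : tailExp c ≠ 0 := by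
  intro e
  have := DFunLike.congr_fun e k
  rw [tailExp_apply] at this
  simp at this
  omega

/-- Nesting makes `y_j / y_k` for `j < k`, and the outer position makes `x_j / y_k`, lie in the unit
disc; absolutely convergent expansions then multiply. -/
lemma hasExpansion_genSeries (lam : ℝ) (x : Fin N → ℝ) {y : Fin N → ℂ}
    (h1 : ∀ j k, j < k → ‖y j‖ < ‖y k‖) (h2 : ∀ k, ‖x‖ < ‖y k‖) :
    HasExpansion (MvPowerSeries.map (evalC x) (genSeries lam)) y
      ((∏ j, ∏ k ∈ Finset.Ioi j, (1 - y j / y k) ^ (lam : ℂ)) /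
        ∏ j, ∏ k, (1 - (x j : ℂ) / y k) ^ (lam : ℂ)) := by
  have hy : ∀ k, y k ≠ 0 := fun k => norm_pos_iff.mp ((norm_nonneg x).trans_lt (h2 k))
  rw [genSeries, map_mul, map_prod, map_prod, div_eq_mul_inv, ← Finset.prod_inv_distrib]
  refine HasExpansion.mul hy (HasExpansion.prod hy fun j _ => ?_)
    (HasExpansion.prod hy fun j _ => ?_)
  · rw [map_prod]
    refine HasExpansion.prod hy fun k hk => ?_
    have hjk := Finset.mem_Ioi.mp hk
    rw [map_binSeries, ratio, mono, MvPowerSeries.map_monomial, map_one]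
    have h3 : (1 : ℂ) * monoEval y (tailExp (Pi.single k 1 - Pi.single j 1)) = y j / y k := by
      rw [one_mul, monoEval_single_sub hy hjk]
    rw [← h3]
    refine HasExpansion.binSeries hy lam (tailExp_ne_zero (k := k) ?_) ?_
    · rw [tail_sub, tail_single, tail_single, if_pos le_rfl, if_neg (not_le.mpr hjk)]; simp
    · rw [h3, norm_div, div_lt_one (norm_pos_iff.mpr (hy k))]
      exact h1 j k hjk
  · rw [map_prod, ← Finset.prod_inv_distrib]
    refine HasExpansion.prod hy fun k _ => ?_
    have e : MvPowerSeries.map (evalC x) (xt j k) =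
        MvPowerSeries.monomial (tailExp (Pi.single k 1)) (x j : ℂ) := by
      rw [xt, tvar, mono, map_mul, MvPowerSeries.map_C, MvPowerSeries.map_monomial,
        ← MvPowerSeries.monomial_zero_eq_C_apply, MvPowerSeries.monomial_mul_monomial]
      simp [evalC]
    have h3 : (x j : ℂ) * monoEval y (tailExp (Pi.single k 1)) = x j / y k := by
      rw [monoEval_single, div_eq_mul_inv]
    rw [map_binSeries, e, ← Complex.cpow_neg, ← Complex.ofReal_neg, ← h3]
    refine HasExpansion.binSeries hy (-lam) (tailExp_ne_zero (k := k) ?_) ?_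
    · rw [tail_single]; simp
    · rw [h3, norm_div, div_lt_one (norm_pos_iff.mpr (hy k)), Complex.norm_real]
      exact (norm_le_pi_norm x j).trans_lt (h2 k)

end

/-! ### Orthogonality on the torus and termwise integration -/

noncomputable section

open MeasureTheory

variable {N : ℕ}

lemma setIntegral_circle_zpow (R : ℝ) (k : ℤ) :
    ∫ θ in Set.Icc (0 : ℝ) (2 * Real.pi), ((R : ℂ) * Complex.exp (θ * Complex.I)) ^ k =
      if k = 0 then 2 * (Real.pi : ℂ) else 0 := by
  rw [integral_Icc_eq_integral_Ioc, ← intervalIntegral.integral_of_le Real.two_pi_pos.le]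
  split_ifs with h
  · subst h
    simp
  · have e : ∀ θ : ℝ, ((R : ℂ) * Complex.exp (θ * Complex.I)) ^ k =
        (R : ℂ) ^ k * Complex.exp (k * Complex.I * θ) := fun θ => by
      rw [mul_zpow, ← Complex.exp_int_mul]
      ring_nf
    simp only [e]
    have hk : (k : ℂ) * Complex.I ≠ 0 := mul_ne_zero (by exact_mod_cast h) Complex.I_ne_zero
    rw [intervalIntegral.integral_const_mul, integral_exp_mul_complex hk]
    have e2 : (k : ℂ) * Complex.I * ((2 * Real.pi : ℝ) : ℂ) = k * (2 * Real.pi * Complex.I) := by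
      push_cast; ring
    rw [e2, Complex.exp_int_mul_two_pi_mul_I]
    simp

lemma setIntegral_torus_zpow (R : Fin N → ℝ) (k : Fin N → ℤ) :
    ∫ θ in Set.Icc (0 : Fin N → ℝ) (fun _ => 2 * Real.pi),
      ∏ j, (1 / (2 * (Real.pi : ℂ)) * ((R j : ℂ) * Complex.exp (θ j * Complex.I)) ^ k j) =
      if k = 0 then 1 else 0 := by
  have e : Set.Icc (0 : Fin N → ℝ) (fun _ => 2 * Real.pi) =
      Set.univ.pi fun _ => Set.Icc (0 : ℝ) (2 * Real.pi) := (Set.pi_univ_Icc _ _).symm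
  rw [e, volume_pi, Measure.restrict_pi_pi, integral_fintype_prod_eq_prod
    (f := fun j (t : ℝ) => 1 / (2 * (Real.pi : ℂ)) *
      ((R j : ℂ) * Complex.exp (t * Complex.I)) ^ k j)]
  simp only [integral_const_mul, setIntegral_circle_zpow]
  have hpi : (Real.pi : ℂ) ≠ 0 := by exact_mod_cast Real.pi_ne_zero
  split_ifs with h
  · subst h
    refine Finset.prod_eq_one fun j _ => ?_
    simp only [Pi.zero_apply, if_true]
    field_simp
  · obtain ⟨j, hj⟩ := Function.ne_iff.mp h
    refine Finset.prod_eq_zero (Finset.mem_univ j) ?_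
    rw [if_neg (by simpa using hj), mul_zero]

/-- Weights and tails are inverse to each other, so at most one exponent survives the torus
integral. -/
lemma intWeight_eq_iff {m : Fin N → ℤ} (b : Fin N →₀ ℕ) :
    (∀ k, intWeight k b = m k) ↔ (∀ k, 0 ≤ tail m k) ∧ b = tailExp m := by
  constructor
  · intro h
    have h1 : (fun k => intWeight k b) = m := funext h
    have h2 : ∀ k, tail m k = b k := fun k => by rw [← h1]; exact tail_intWeight b k
    refine ⟨fun k => by rw [h2]; positivity, ?_⟩
    ext k
    rw [tailExp_apply, h2, Int.toNat_natCast]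
  · rintro ⟨h, rfl⟩ k
    exact intWeight_tailExp k h

/-- Termwise integration: the torus integral of `∏ y_j ^ m_j / (2 π i y_j)` times a function with
an absolutely convergent expansion extracts a coefficient. -/
lemma torusIntegral_of_hasExpansion (p : MvPowerSeries (Fin N) ℂ) (m : Fin N → ℤ) (R : Fin N → ℝ)
    (hR : ∀ j, 0 < R j) (v : (Fin N → ℂ) → ℂ)
    (h : ∀ θ, HasExpansion p (torusMap 0 R θ) (v (torusMap 0 R θ))) :
    torusIntegral (fun y => (∏ j, y j ^ m j / (2 * (Real.pi : ℂ) * Complex.I * y j)) * v y) 0 R =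
      if ∀ k, 0 ≤ tail m k then MvPowerSeries.coeff (tailExp m) p else 0 := by
  classical
  have hy : ∀ θ : Fin N → ℝ, ∀ j, torusMap 0 R θ j ≠ 0 := fun θ j => by
    simp [torusMap, (hR j).ne']
  let T : (Fin N →₀ ℕ) → (Fin N → ℝ) → ℂ := fun b θ => MvPowerSeries.coeff b p *
    ∏ j, (1 / (2 * (Real.pi : ℂ)) * ((R j : ℂ) * Complex.exp (θ j * Complex.I)) ^
      (m j - intWeight j b))
  have e1 : ∀ θ, (∏ i, (R i : ℂ) * Complex.exp (θ i * Complex.I) * Complex.I) •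
      ((∏ j, torusMap 0 R θ j ^ m j / (2 * (Real.pi : ℂ) * Complex.I * torusMap 0 R θ j)) *
        v (torusMap 0 R θ)) = ∑' b, T b θ := by
    intro θ
    rw [← (h θ).tsum_eq, smul_eq_mul, ← mul_assoc, ← Finset.prod_mul_distrib, ← tsum_mul_left]
    refine tsum_congr fun b => ?_
    simp only [T, monoEval]
    rw [mul_left_comm, ← Finset.prod_mul_distrib]
    congr 1
    refine Finset.prod_congr rfl fun j _ => ?_
    have h1 := hy θ j
    have h2 : (R j : ℂ) * Complex.exp (θ j * Complex.I) = torusMap 0 R θ j := by simp [torusMap]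
    have hpi : (Real.pi : ℂ) ≠ 0 := by exact_mod_cast Real.pi_ne_zero
    rw [h2, sub_eq_add_neg, zpow_add₀ h1]
    field_simp [Complex.I_ne_zero]
  have e2 : ∀ b, ∫ θ in Set.Icc (0 : Fin N → ℝ) (fun _ => 2 * Real.pi), T b θ =
      if (∀ k, 0 ≤ tail m k) ∧ b = tailExp m then MvPowerSeries.coeff b p else 0 := by
    intro b
    simp only [T]
    rw [integral_const_mul, setIntegral_torus_zpow R fun j => m j - intWeight j b]
    have : ((fun j => m j - intWeight j b) = 0) ↔ (∀ k, 0 ≤ tail m k) ∧ b = tailExp m := by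
      rw [← intWeight_eq_iff, funext_iff]
      exact forall_congr' fun k => ⟨fun h => by simp at h; omega, fun h => by simp; omega⟩
    simp only [this]
    split_ifs <;> simp
  -- On the torus the modulus of each term is constant, so absolute convergence at the single point
  -- `θ = 0` justifies exchanging sum and integral.
  have hnorm : ∀ b θ, ‖T b θ‖ = ‖T b 0‖ := by
    intro b θ
    simp only [T, norm_mul, norm_prod, norm_zpow, Complex.norm_exp_ofReal_mul_I]
  have hcont : ∀ b, Continuous (T b) := by
    intro b
    refine continuous_const.mul (continuous_finsetProd _ fun j _ => continuous_const.mul ?_)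
    refine Continuous.zpow₀ (by fun_prop) _ fun θ => Or.inl ?_
    exact mul_ne_zero (by exact_mod_cast (hR j).ne') (Complex.exp_ne_zero _)
  have hsum : Summable fun b => ‖T b 0‖ := by
    have h1 := (h 0).summable.mul_left ‖∏ j, (1 / (2 * (Real.pi : ℂ)) * torusMap 0 R 0 j ^ m j)‖
    refine h1.congr fun b => ?_
    rw [← norm_mul]
    congr 1
    simp only [T, monoEval]
    rw [mul_left_comm, ← Finset.prod_mul_distrib]
    congr 1
    refine Finset.prod_congr rfl fun j _ => ?_
    have h2 : (R j : ℂ) * Complex.exp (((0 : Fin N → ℝ) j : ℝ) * Complex.I) =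
      torusMap 0 R 0 j := by simp [torusMap]
    rw [h2, sub_eq_add_neg, zpow_add₀ (hy 0 j), mul_assoc]
  have hint := hasSum_integral_of_summable_integral_norm (F := T)
    (μ := volume.restrict (Set.Icc (0 : Fin N → ℝ) (fun _ => 2 * Real.pi)))
    (fun b => (hcont b).integrableOn_Icc) (by
      simp only [hnorm, integral_const, smul_eq_mul]
      exact hsum.mul_left _)
  rw [torusIntegral]
  simp only [e1]
  rw [← hint.tsum_eq]
  simp only [e2]
  split_ifs with h0
  · simp [h0]
  · simp [h0]

/-- The contour integrals `f_m` are the polynomials `fPoly`. -/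
lemma f_eq_fPoly (lam : ℝ) {ε : ℝ} (hε : 0 < ε) (m : Fin N → ℤ) (x : Fin N → ℝ) :
    f lam ε m x = ((MvPolynomial.eval x (fPoly lam m) : ℝ) : ℂ) := by
  have hR : ∀ j, ‖x‖ < radius ε x j := fun j => by
    rw [radius]
    have : 0 < ε * ((j : ℝ) + 1) := by positivity
    linarith
  have hR0 : ∀ j, 0 < radius ε x j := fun j => (norm_nonneg x).trans_lt (hR j)
  have hn : ∀ θ j, ‖torusMap 0 (radius ε x) θ j‖ = radius ε x j := fun θ j => by
    simp [torusMap, abs_of_pos (hR0 j)]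
  have h := torusIntegral_of_hasExpansion (MvPowerSeries.map (evalC x) (genSeries lam)) m
    (radius ε x) hR0 (fun y => (∏ j, ∏ k ∈ Finset.Ioi j, (1 - y j / y k) ^ (lam : ℂ)) /
        ∏ j, ∏ k, (1 - (x j : ℂ) / y k) ^ (lam : ℂ)) fun θ => by
      refine hasExpansion_genSeries lam x (fun j k hjk => ?_) fun k => ?_
      · rw [hn, hn, radius, radius]
        have : (j : ℝ) < k := by exact_mod_cast hjk
        have := mul_lt_mul_of_pos_left (add_lt_add_left this 1) hε
        linarith
      · rw [hn]; exact hR k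
  refine h.trans ?_
  split_ifs with h0
  · rw [MvPowerSeries.coeff_map, fPoly, coeffAt_of_nonneg h0]
    rfl
  · rw [fPoly, coeffAt_of_neg (by push Not at h0; exact h0)]
    simp

/-- Permuting the `x_j` changes neither the radii, which use the maximum norm, nor the integrand.
The value `ε = 1` is arbitrary, and a real polynomial is determined by its values. -/
lemma isSymmetric_fPoly (lam : ℝ) (m : Fin N → ℤ) : (fPoly lam m).IsSymmetric := by
  intro e
  refine MvPolynomial.funext fun x => ?_
  rw [MvPolynomial.eval_rename]
  have h : f lam 1 m (x ∘ e) = f lam 1 m x := by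
    have hnorm : ‖x ∘ e‖ = ‖x‖ := e.surjective.pi_norm_comp x
    have h1 : radius 1 (x ∘ e) = radius 1 x := by funext j; rw [radius, radius, hnorm]
    have h2 : fIntegrand lam m (x ∘ e) = fIntegrand lam m x := by
      funext y
      simp only [fIntegrand, Function.comp_apply]
      rw [Equiv.prod_comp e fun j => ∏ k, (1 - (x j : ℂ) / y k) ^ (lam : ℂ)]
    rw [f, f, h1, h2]
  rw [f_eq_fPoly lam one_pos, f_eq_fPoly lam one_pos] at h
  exact_mod_cast h

end

noncomputable section

/-! ### Conjugation of the Hamiltonian by the groundstate -/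

open Topology

variable {N : ℕ}

lemma hasDerivAt_prod_of_log {ι : Type*} (s : Finset ι) (u : ι → ℝ → ℂ) (a : ι → ℂ) {t : ℝ}
    (h : ∀ i ∈ s, HasDerivAt (u i) (a i * u i t) t) :
    HasDerivAt (fun t => ∏ i ∈ s, u i t) ((∑ i ∈ s, a i) * ∏ i ∈ s, u i t) t := by
  classical
  induction s using Finset.induction_on with
  | empty => simpa using hasDerivAt_const t (1 : ℂ)
  | insert i s hi ih =>
    simp only [Finset.prod_insert hi, Finset.sum_insert hi]
    refine ((h i (Finset.mem_insert_self _ _)).mul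
      (ih fun j hj => h j (Finset.mem_insert_of_mem hj))).congr_deriv ?_
    ring

lemma hasDerivAt_update (x : Fin N → ℝ) (j i : Fin N) (t : ℝ) :
    HasDerivAt (fun t => Function.update x j t i) (if i = j then 1 else 0) t := by
  by_cases h : i = j
  · subst h
    simpa using hasDerivAt_id' t
  · simpa [Function.update_of_ne h, h] using hasDerivAt_const t (x i)

lemma hasDerivAt_ofReal_cpow_of_log {r : ℝ → ℝ} {d t : ℝ} (hr : HasDerivAt r d t) (h0 : r t ≠ 0)
    {lam : ℝ} (hlam : lam ≠ 0) :
    HasDerivAt (fun t => (r t : ℂ) ^ (lam : ℂ))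
      (((lam * (d * (r t)⁻¹) : ℝ) : ℂ) * (r t : ℂ) ^ (lam : ℂ)) t := by
  have h := (hasDerivAt_ofReal_cpow_const h0 (r := (lam : ℂ)) (by exact_mod_cast hlam)).scomp t hr
  refine h.congr_deriv ?_
  have h1 : (r t : ℂ) ≠ 0 := by exact_mod_cast h0
  rw [Complex.cpow_sub _ _ h1, Complex.cpow_one, Complex.real_smul]
  push_cast
  field_simp

/-- The logarithmic derivative of the groundstate in the direction `j`. -/
def groundLogDer (lam : ℝ) (j : Fin N) (x : Fin N → ℝ) : ℝ :=
  -x j + lam * ∑ k, (x j - x k)⁻¹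

/-- The summand is symmetric in `i` and `k`, so the sum over pairs is half of the full double sum.
The diagonal term on the right is `0⁻¹ = 0`. -/
lemma sum_Ioi_logDer (x : Fin N → ℝ) (j : Fin N) :
    ∑ i : Fin N, ∑ k ∈ Finset.Ioi i,
      ((if k = j then (1 : ℝ) else 0) - if i = j then 1 else 0) * (x k - x i)⁻¹ =
      ∑ k, (x j - x k)⁻¹ := by
  have h := sum_sum_eq_diag_add_two_mul (fun i k : Fin N =>
    ((if k = j then (1 : ℝ) else 0) - if i = j then 1 else 0) * (x k - x i)⁻¹) fun i k => by
      rw [← neg_sub (x k), inv_neg]; ring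
  have h1 : ∑ i, ∑ k, ((if k = j then (1 : ℝ) else 0) - if i = j then 1 else 0) * (x k - x i)⁻¹ =
      2 * ∑ k, (x j - x k)⁻¹ := by
    have e : ∀ k, (x k - x j)⁻¹ = -(x j - x k)⁻¹ := fun k => by rw [← neg_sub (x j), inv_neg]
    simp only [sub_mul, Finset.sum_sub_distrib, ite_mul, one_mul, zero_mul, Finset.sum_ite_eq',
      Finset.mem_univ, if_true]
    rw [Finset.sum_comm]
    simp only [Finset.sum_ite_eq', Finset.mem_univ, if_true, e, Finset.sum_neg_distrib]
    ring
  rw [h1] at h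
  simp only [sub_self, zero_mul, Finset.sum_const_zero, zero_add] at h
  linarith

lemma hasDerivAt_groundState {lam : ℝ} (hlam : lam ≠ 0) {x : Fin N → ℝ} (j : Fin N) {t : ℝ}
    (hx : Function.Injective (Function.update x j t)) :
    HasDerivAt (fun t => groundState lam (Function.update x j t))
      ((groundLogDer lam j (Function.update x j t) : ℂ) *
        groundState lam (Function.update x j t)) t := by
  have h1 := hasDerivAt_prod_of_log Finset.univ
    (fun i t => Complex.exp (-(1 / 2) * (Function.update x j t i : ℂ) ^ 2))
    (fun i => ((-(if i = j then 1 else 0) * Function.update x j t i : ℝ) : ℂ)) (t := t)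
    fun i _ => by
      have h := (((hasDerivAt_update x j i t).ofReal_comp.fun_pow 2).const_mul (-(1 / 2) : ℂ)).cexp
      refine h.congr_deriv ?_
      push_cast
      ring
  have h2 := hasDerivAt_prod_of_log Finset.univ
    (fun i t => ∏ k ∈ Finset.Ioi i,
      ((Function.update x j t k : ℂ) - (Function.update x j t i : ℂ)) ^ (lam : ℂ)) _ (t := t)
    fun i _ => hasDerivAt_prod_of_log (Finset.Ioi i)
      (fun k t => ((Function.update x j t k : ℂ) - (Function.update x j t i : ℂ)) ^ (lam : ℂ))
      (fun k => ((lam * (((if k = j then 1 else 0) - (if i = j then 1 else 0)) *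
        (Function.update x j t k - Function.update x j t i)⁻¹) : ℝ) : ℂ))
      fun k hk => by
        have h := hasDerivAt_ofReal_cpow_of_log (lam := lam)
          ((hasDerivAt_update x j k t).sub (hasDerivAt_update x j i t))
          (sub_ne_zero.mpr fun e => (Finset.mem_Ioi.mp hk).ne' (hx e)) hlam
        simpa only [Pi.sub_apply, Complex.ofReal_sub] using h
  refine (h1.mul h2).congr_deriv ?_
  have e1 : ∑ i, ((-(if i = j then 1 else 0) * Function.update x j t i : ℝ) : ℂ) =
      ((-Function.update x j t j : ℝ) : ℂ) := by
    rw [← Complex.ofReal_sum]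
    simp
  simp only [← Complex.ofReal_sum, ← Finset.mul_sum] at e1 ⊢
  rw [e1, sum_Ioi_logDer, groundLogDer, groundState]
  push_cast
  ring

lemma hasDerivAt_eval_update (p : MvPolynomial (Fin N) ℝ) (x : Fin N → ℝ) (j : Fin N) (t : ℝ) :
    HasDerivAt (fun t => MvPolynomial.eval (Function.update x j t) p)
      (MvPolynomial.eval (Function.update x j t) (MvPolynomial.pderiv j p)) t := by
  induction p using MvPolynomial.induction_on with
  | C a => simpa using hasDerivAt_const t a
  | add p q hp hq => simpa only [map_add] using hp.fun_add hq
  | mul_X p i hp =>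
    have h := hp.mul (hasDerivAt_update x j i t)
    simp only [map_mul, MvPolynomial.eval_X, Derivation.leibniz, MvPolynomial.pderiv_X, map_add,
      smul_eq_mul]
    refine h.congr_deriv ?_
    by_cases hij : i = j
    · subst hij; simp; ring
    · simp [hij]; ring

lemma contDiff_eval (p : MvPolynomial (Fin N) ℝ) :
    ContDiff ℝ 2 (fun x : Fin N → ℝ => MvPolynomial.eval x p) := by
  induction p using MvPolynomial.induction_on with
  | C a => simpa using contDiff_const
  | add p q hp hq => simpa only [map_add] using hp.add hq
  | mul_X p i hp =>
    simp only [map_mul, MvPolynomial.eval_X]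
    exact hp.mul (contDiff_apply ℝ ℝ i)

/-- On the negative axis the principal power is the real power of `-t` times the constant phase `exp
(π i λ)`. -/
lemma contDiffAt_ofReal_cpow (lam : ℝ) {t : ℝ} (ht : t ≠ 0) :
    ContDiffAt ℝ 2 (fun t : ℝ => (t : ℂ) ^ (lam : ℂ)) t := by
  have hpos : ∀ {s : ℝ}, 0 < s → ContDiffAt ℝ 2 (fun t : ℝ => (t : ℂ) ^ (lam : ℂ)) s := by
    intro s hs
    have h : ContDiffAt ℝ 2 (fun t : ℝ => ((t ^ lam : ℝ) : ℂ)) s :=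
      Complex.ofRealCLM.contDiff.contDiffAt.comp s (Real.contDiffAt_rpow_const_of_ne hs.ne')
    refine h.congr_of_eventuallyEq ?_
    filter_upwards [lt_mem_nhds hs] with u hu
    rw [Complex.ofReal_cpow hu.le]
  rcases ht.lt_or_gt with h | h
  · have h1 : ContDiffAt ℝ 2 (fun t : ℝ => ((-t : ℝ) : ℂ) ^ (lam : ℂ) *
        Complex.exp (Real.pi * Complex.I * lam)) t :=
      ((hpos (neg_pos.mpr h)).comp t contDiffAt_id.neg).mul contDiffAt_const
    refine h1.congr_of_eventuallyEq ?_
    filter_upwards [gt_mem_nhds h] with u hu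
    rw [Complex.ofReal_cpow_of_nonpos hu.le, Complex.ofReal_neg]
  · exact hpos h

lemma contDiffAt_groundState (lam : ℝ) {x : Fin N → ℝ} (hx : Function.Injective x) :
    ContDiffAt ℝ 2 (groundState lam) x := by
  have hc : ∀ j : Fin N, ContDiff ℝ 2 fun x : Fin N → ℝ => (x j : ℂ) := fun j =>
    Complex.ofRealCLM.contDiff.comp (contDiff_apply ℝ ℝ j)
  refine ContDiffAt.mul ?_ ?_
  · refine contDiffAt_prod fun j _ => ?_
    exact (contDiff_const.mul ((hc j).pow 2)).cexp.contDiffAt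
  · refine contDiffAt_prod fun j _ => contDiffAt_prod fun k hk => ?_
    have h1 : ContDiffAt ℝ 2 (fun x : Fin N → ℝ => x k - x j) x :=
      ((contDiff_apply ℝ ℝ k).sub (contDiff_apply ℝ ℝ j)).contDiffAt
    have h2 := (contDiffAt_ofReal_cpow lam
      (sub_ne_zero.mpr fun e => (Finset.mem_Ioi.mp hk).ne' (hx e))).comp x h1
    simpa only [Function.comp_def, Complex.ofReal_sub] using h2

/-- Distinctness is an open condition. It makes first-derivative formulas valid near the point, so
that they can be differentiated again. -/
lemma eventually_injective_update {x : Fin N → ℝ} (hx : Function.Injective x) (j : Fin N) :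
    ∀ᶠ t in 𝓝 (x j), Function.Injective (Function.update x j t) := by
  have h : ∀ i k : Fin N, i ≠ k →
      ∀ᶠ t in 𝓝 (x j), Function.update x j t i ≠ Function.update x j t k := by
    intro i k hik
    have h1 := (hasDerivAt_update x j i (x j)).continuousAt.sub
      (hasDerivAt_update x j k (x j)).continuousAt
    filter_upwards [h1.eventually_ne (y := 0) (by simpa [sub_eq_zero] using fun e => hik (hx e))]
      with t ht e
    exact ht (sub_eq_zero.mpr e)
  have h' : ∀ᶠ t in 𝓝 (x j), ∀ i k : Fin N, i ≠ k →
      Function.update x j t i ≠ Function.update x j t k := by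
    simp only [Filter.eventually_all]
    exact h
  filter_upwards [h'] with t ht i k e
  by_contra hne
  exact ht i k hne e

lemma hasDerivAt_groundLogDer (lam : ℝ) {x : Fin N → ℝ} (hx : Function.Injective x) (j : Fin N) :
    HasDerivAt (fun t => groundLogDer lam j (Function.update x j t))
      (-1 - lam * ∑ k, ((x j - x k)⁻¹) ^ 2) (x j) := by
  have h1 : ∀ k ∈ Finset.univ, HasDerivAt
      (fun t => (Function.update x j t j - Function.update x j t k)⁻¹)
      (-((x j - x k)⁻¹) ^ 2) (x j) := fun k _ => by
    -- The diagonal term is constantly `0⁻¹ = 0`, in agreement with the claimed derivative.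
    by_cases hk : k = j
    · subst hk
      simpa using hasDerivAt_const (x k) (0 : ℝ)
    · have h0 : x j - x k ≠ 0 := sub_ne_zero.mpr fun e => hk (hx e).symm
      have h2 := ((hasDerivAt_update x j j (x j)).sub (hasDerivAt_update x j k (x j))).inv
        (by simpa using h0)
      refine h2.congr_deriv ?_
      simp [hk]
      field_simp
  have h2 := (hasDerivAt_update x j j (x j)).neg.add ((HasDerivAt.fun_sum h1).const_mul lam)
  refine h2.congr_deriv ?_
  simp [Finset.sum_neg_distrib]
  ring

/-- With `ψ' = u ψ`, differentiating twice gives `(ψ p)'' = ψ ((u² + u') p + 2 u p' + p'')`. -/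
lemma secondPartial_groundState_mul {lam : ℝ} (hlam : lam ≠ 0) (p : MvPolynomial (Fin N) ℝ)
    {x : Fin N → ℝ} (hx : Function.Injective x) (j : Fin N) :
    secondPartial (fun x => groundState lam x * ((MvPolynomial.eval x p : ℝ) : ℂ)) j x =
      groundState lam x *
        (((groundLogDer lam j x ^ 2 - 1 - lam * ∑ k, ((x j - x k)⁻¹) ^ 2) * MvPolynomial.eval x p +
          2 * groundLogDer lam j x * MvPolynomial.eval x (MvPolynomial.pderiv j p) +
          MvPolynomial.eval x (MvPolynomial.pderiv j (MvPolynomial.pderiv j p)) : ℝ) : ℂ) := by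
  have h1 : ∀ᶠ t in 𝓝 (x j),
      deriv (fun t => groundState lam (Function.update x j t) *
        ((MvPolynomial.eval (Function.update x j t) p : ℝ) : ℂ)) t =
      groundState lam (Function.update x j t) *
        ((groundLogDer lam j (Function.update x j t) *
          MvPolynomial.eval (Function.update x j t) p +
          MvPolynomial.eval (Function.update x j t) (MvPolynomial.pderiv j p) : ℝ) : ℂ) := by
    filter_upwards [eventually_injective_update hx j] with t ht
    rw [((hasDerivAt_groundState hlam j ht).fun_mul
      (hasDerivAt_eval_update p x j t).ofReal_comp).deriv]
    push_cast
    ring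
  have hx' : Function.Injective (Function.update x j (x j)) := by rwa [Function.update_eq_self]
  have h2 := (hasDerivAt_groundState hlam j hx').mul
    (((hasDerivAt_groundLogDer lam hx j).mul (hasDerivAt_eval_update p x j (x j))).add
      (hasDerivAt_eval_update (MvPolynomial.pderiv j p) x j (x j))).ofReal_comp
  rw [secondPartial, iteratedDeriv_succ, iteratedDeriv_one, Filter.EventuallyEq.deriv_eq h1]
  refine h2.deriv.trans ?_
  simp only [Function.update_eq_self]
  push_cast
  simp only [Pi.mul_apply, Pi.add_apply, Function.update_eq_self]
  push_cast
  ring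

/-- Antisymmetry of `(x_j - x_k)⁻¹` pairs the terms `(j, k)` and `(k, j)` into difference quotients.
-/
lemma sum_inv_mul_pderiv {x : Fin N → ℝ} (hx : Function.Injective x) (D : Fin N → ℝ)
    (q : Fin N → Fin N → ℝ) (hq : ∀ i j, (x i - x j) * q i j = D i - D j) :
    ∑ j, (∑ k, (x j - x k)⁻¹) * D j = ∑ i : Fin N, ∑ j ∈ Finset.Ioi i, q i j := by
  have h := sum_sum_eq_diag_add_two_mul (fun i j : Fin N => (x i - x j)⁻¹ * (D i - D j))
    fun i j => by rw [← neg_sub (x j), inv_neg]; ring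
  have h1 : ∑ i : Fin N, ∑ j ∈ Finset.Ioi i, (x i - x j)⁻¹ * (D i - D j) =
      ∑ i : Fin N, ∑ j ∈ Finset.Ioi i, q i j := by
    refine Finset.sum_congr rfl fun i _ => Finset.sum_congr rfl fun j hj => ?_
    have h0 : x i - x j ≠ 0 := sub_ne_zero.mpr fun e => (Finset.mem_Ioi.mp hj).ne (hx e)
    rw [← hq, inv_mul_cancel_left₀ h0]
  have h2 : ∑ i : Fin N, ∑ j, (x i - x j)⁻¹ * (D i - D j) =
      2 * ∑ j, (∑ k, (x j - x k)⁻¹) * D j := by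
    have e : ∑ i : Fin N, ∑ j, (x i - x j)⁻¹ * D j = -∑ i : Fin N, ∑ j, (x i - x j)⁻¹ * D i := by
      rw [Finset.sum_comm, ← Finset.sum_neg_distrib]
      refine Finset.sum_congr rfl fun i _ => ?_
      rw [← Finset.sum_neg_distrib]
      exact Finset.sum_congr rfl fun j _ => by rw [← neg_sub (x i), inv_neg]; ring
    simp only [mul_sub, Finset.sum_sub_distrib, e, Finset.sum_mul]
    ring
  rw [h1, h2] at h
  simp only [sub_self, mul_zero, Finset.sum_const_zero, zero_add] at h
  linarith

/-- The eigenvalue equation of the groundstate itself. The three-body terms cancel cyclically, the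
cross terms `x_j / (x_j - x_k)` pair to 1 and give the constant, and the two-body terms carry `λ²`
from the square and `-λ` from the derivative. -/
lemma sum_groundLogDer {x : Fin N → ℝ} (hx : Function.Injective x) (lam : ℝ) :
    ∑ j, (groundLogDer lam j x ^ 2 - 1 - lam * ∑ k, ((x j - x k)⁻¹) ^ 2) =
      ∑ j, x j ^ 2 - N * (1 + lam * ((N : ℝ) - 1)) +
        2 * lam * (lam - 1) * ∑ j, ∑ k ∈ Finset.Ioi j, 1 / (x j - x k) ^ 2 := by
  have h1 := sum_mul_sq_sum_of_cyclic (fun _ : Fin N => (1 : ℝ)) (fun j k => (x j - x k)⁻¹)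
    (fun k => by simp) fun k l m hkl hkm hlm => by
      have e1 : x k - x l ≠ 0 := sub_ne_zero.mpr fun e => hkl (hx e)
      have e2 : x k - x m ≠ 0 := sub_ne_zero.mpr fun e => hkm (hx e)
      have e3 : x l - x m ≠ 0 := sub_ne_zero.mpr fun e => hlm (hx e)
      rw [← neg_sub (x k) (x l), ← neg_sub (x k) (x m), ← neg_sub (x l) (x m)]
      field_simp
      ring
  simp only [one_mul] at h1
  have h2 : 2 * ∑ j, x j * ∑ k, (x j - x k)⁻¹ = N * ((N : ℝ) - 1) := by
    have e : ∑ j, x j * ∑ k, (x j - x k)⁻¹ = -∑ j, ∑ k, x k * (x j - x k)⁻¹ := by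
      rw [Finset.sum_comm (f := fun j k => x k * (x j - x k)⁻¹), ← Finset.sum_neg_distrib]
      refine Finset.sum_congr rfl fun j _ => ?_
      rw [Finset.mul_sum, ← Finset.sum_neg_distrib]
      exact Finset.sum_congr rfl fun k _ => by rw [← neg_sub (x k), inv_neg]; ring
    have e2 : ∀ j k : Fin N, x j * (x j - x k)⁻¹ - x k * (x j - x k)⁻¹ =
        1 - if j = k then 1 else 0 := fun j k => by
      rw [← sub_mul]
      split_ifs with h
      · subst h; simp
      · rw [mul_inv_cancel₀ (sub_ne_zero.mpr fun e => h (hx e)), sub_zero]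
    rw [two_mul]
    nth_rw 2 [e]
    simp only [Finset.mul_sum, ← sub_eq_add_neg, ← Finset.sum_sub_distrib, e2]
    simp
    ring
  have h3 := sum_sum_eq_diag_add_two_mul (fun j k : Fin N => ((x j - x k)⁻¹) ^ 2) fun j k => by
    rw [← neg_sub (x k), inv_neg, neg_sq]
  simp only [sub_self, inv_zero, ne_eq, OfNat.ofNat_ne_zero, not_false_eq_true, zero_pow,
    Finset.sum_const_zero, zero_add] at h3
  have h4 : ∀ j k : Fin N, 1 / (x j - x k) ^ 2 = ((x j - x k)⁻¹) ^ 2 := fun j k => by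
    rw [inv_pow, one_div]
  have h5 : ∀ j, groundLogDer lam j x ^ 2 = x j ^ 2 - 2 * lam * (x j * ∑ k, (x j - x k)⁻¹) +
      lam ^ 2 * (∑ k, (x j - x k)⁻¹) ^ 2 := fun j => by rw [groundLogDer]; ring
  simp only [h4, h5, Finset.sum_sub_distrib, Finset.sum_add_distrib, ← Finset.mul_sum]
  simp only [Finset.sum_const, Finset.card_univ, Fintype.card_fin, nsmul_eq_mul, mul_one]
  linear_combination lam ^ 2 * h1 - lam * h2 + (lam ^ 2 - lam) * h3

/-- The potential cancels against `sum_groundLogDer`, leaving the groundstate energy. The mixed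
terms `-2 u_j ∂_j` become the first-order part of the reduced operator, and `pPoly_eigen` concludes.
-/
lemma solvesSchrodinger_pPoly {lam : ℝ} (hlam : lam ≠ 0) (n : Fin N → ℤ) :
    SolvesSchrodinger lam
      (fun x => groundState lam x * ((MvPolynomial.eval x (pPoly lam n) : ℝ) : ℂ))
      (energy lam n) := by
  intro x hx
  refine ⟨(contDiffAt_groundState lam hx).mul
    (Complex.ofRealCLM.contDiff.comp (contDiff_eval _)).contDiffAt, ?_⟩
  have h1 := congrArg (MvPolynomial.eval x) (pPoly_eigen lam n)
  simp only [map_add, map_sub, map_neg, map_sum, map_mul, MvPolynomial.smul_eval,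
    MvPolynomial.eval_X] at h1
  have h2 := sum_inv_mul_pderiv hx
    (fun j => MvPolynomial.eval x (MvPolynomial.pderiv j (pPoly lam n)))
    (fun i j => MvPolynomial.eval x (pQuot lam n i j)) fun i j => by
      simpa using congrArg (MvPolynomial.eval x) (sub_mul_pQuot lam n i j)
  have h3 := sum_groundLogDer hx lam
  have h4 : ∑ j, groundLogDer lam j x * MvPolynomial.eval x (MvPolynomial.pderiv j (pPoly lam n)) =
      -∑ j, x j * MvPolynomial.eval x (MvPolynomial.pderiv j (pPoly lam n)) +
        lam * ∑ j, (∑ k, (x j - x k)⁻¹) *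
          MvPolynomial.eval x (MvPolynomial.pderiv j (pPoly lam n)) := by
    rw [Finset.mul_sum, ← Finset.sum_neg_distrib, ← Finset.sum_add_distrib]
    exact Finset.sum_congr rfl fun j _ => by rw [groundLogDer]; ring
  have key : ∑ j, (-((groundLogDer lam j x ^ 2 - 1 - lam * ∑ k, ((x j - x k)⁻¹) ^ 2) *
        MvPolynomial.eval x (pPoly lam n) +
          2 * groundLogDer lam j x * MvPolynomial.eval x (MvPolynomial.pderiv j (pPoly lam n)) +
          MvPolynomial.eval x (MvPolynomial.pderiv j (MvPolynomial.pderiv j (pPoly lam n)))) +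
        x j ^ 2 * MvPolynomial.eval x (pPoly lam n)) +
      2 * lam * (lam - 1) * (∑ j, ∑ k ∈ Finset.Ioi j, 1 / (x j - x k) ^ 2) *
        MvPolynomial.eval x (pPoly lam n) = energy lam n * MvPolynomial.eval x (pPoly lam n) := by
    simp only [neg_add, Finset.sum_add_distrib, Finset.sum_neg_distrib, ← Finset.sum_mul]
    simp only [mul_assoc (2 : ℝ) (groundLogDer lam _ x), ← Finset.mul_sum]
    rw [h4, h3, h2, energy]
    linear_combination h1
  have key' := congrArg (fun r : ℝ => groundState lam x * (r : ℂ)) key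
  rw [hamiltonian]
  simp only [secondPartial_groundState_mul hlam _ hx]
  rw [Complex.ofReal_mul (energy lam n), mul_left_comm] at key'
  refine Eq.trans ?_ key'
  push_cast
  rw [mul_add]
  congr 1
  · rw [Finset.mul_sum]
    exact Finset.sum_congr rfl fun j _ => by ring
  · ring

lemma P_eq_pPoly (lam : ℝ) {ε : ℝ} (hε : 0 < ε) (n : Fin N → ℤ) (x : Fin N → ℝ) :
    P lam ε n x = ((MvPolynomial.eval x (pPoly lam n) : ℝ) : ℂ) := by
  rw [P, pPoly, map_sum, Complex.ofReal_sum,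
    finsum_eq_finsetSum_of_support_subset (s := (tailBox_finite n).toFinset)]
  · refine Finset.sum_congr rfl fun m _ => ?_
    rw [f_eq_fPoly lam hε, MvPolynomial.smul_eval, Complex.ofReal_mul]
  -- The lattice sum defining `P` has its support in the finite box, so it is a genuine finite sum
  -- and not the default value 0.
  · intro m hm
    rw [Function.mem_support, f_eq_fPoly lam hε] at hm
    rw [Set.Finite.coe_toFinset]
    refine mem_tailBox (lam := lam) ?_ ?_
    · intro h; simp [h] at hm
    · intro h; simp [h] at hm

lemma isSymmetric_pPoly (lam : ℝ) (n : Fin N → ℤ) : (pPoly lam n).IsSymmetric := by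
  intro e
  simp only [pPoly, map_sum, map_smul, isSymmetric_fPoly lam _ e]

end
end Calogero

theorem theorem1 (N : ℕ) (hN : 1 ≤ N) (lam : ℝ) (hlam : 0 < lam) (n : Fin N → ℤ) :
    -- the functions `f_m` are symmetric polynomials that do not depend on `ε`
    (∀ m : Fin N → ℤ, ∀ ε : ℝ, 0 < ε → Calogero.IsSymmPolynomial (Calogero.f lam ε m)) ∧
    (∀ m : Fin N → ℤ, ∀ ε ε' : ℝ, 0 < ε → 0 < ε' → Calogero.f lam ε m = Calogero.f lam ε' m) ∧
    -- the sums that define `α_n(m)` and `P_n` have only finitely many non-zero terms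
    (∀ m : Fin N → ℤ,
      {c : Σ s : ℕ, Fin s → Calogero.Step N | Calogero.chainTerm lam n m c.2 ≠ 0}.Finite) ∧
    (∀ ε : ℝ, 0 < ε →
      {m : Fin N → ℤ | Calogero.alpha lam n m ≠ 0 ∧ Calogero.f lam ε m ≠ 0}.Finite) ∧
    -- `P_n` is a reduced polynomial eigenfunction with eigenvalue `E_n`
    (∀ ε : ℝ, 0 < ε →
      Calogero.IsReducedPolynomialEigenfunction lam (Calogero.P lam ε n)
        (Calogero.energy lam n)) := by
  refine ⟨fun m ε hε => ⟨Calogero.fPoly lam m, Calogero.isSymmetric_fPoly lam m,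
    Calogero.f_eq_fPoly lam hε m⟩, fun m ε ε' hε hε' => ?_,
    fun m => Calogero.finite_chainTerm_ne_zero lam n m, fun ε hε => ?_, fun ε hε => ⟨?_, ?_⟩⟩
  · funext x
    rw [Calogero.f_eq_fPoly lam hε, Calogero.f_eq_fPoly lam hε']
  · refine (Calogero.tailBox_finite n).subset fun m hm => ?_
    refine Calogero.mem_tailBox hm.1 fun h => hm.2 ?_
    funext x
    rw [Calogero.f_eq_fPoly lam hε, h]
    simp
  · exact ⟨Calogero.pPoly lam n, Calogero.isSymmetric_pPoly lam n, Calogero.P_eq_pPoly lam hε n⟩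
  · simp only [Calogero.P_eq_pPoly lam hε]
    exact Calogero.solvesSchrodinger_pPoly hlam.ne' n
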